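/- **Setting.** Let $\gamma_n=c_n+c_n^\dagger$ and $\tilde\gamma_n=i(c_n^\dagger-c_n)$, $n\ge 0$, be the Majorana operators of spinless fermions on the sites $0,1,2,\dots$ (acting on fermionic Fock space). For real couplings $(t_n)_{n\in\mathbb Z}$ with $\sum_n|t_n|<\infty$ put $f(z)=\sum_{n\in\mathbb Z}t_nz^n$ for $|z|=1$. The half-infinite open chain is $H=\frac i2\sum_{m,n\ge 0}t_{m-n}\tilde\gamma_n\gamma_m$, understood as the limit of the open chains $H_N$ on the sites $0,\dots,N-1$. For real $g_n$, an operator $\Gamma=\sum_{n\ge0}g_n\gamma_n$ (or $\sum_{n\ge 0} g_n\tilde\gamma_n$) is a *localized (normalisable) zero-energy edge mode* if $\sum_n g_n^2<\infty$ and $[\Gamma,H]=0$, that is $[\Gamma,H_N]\to0$ in operator norm as $N\to\infty$. Couplings are *$\alpha$-decaying* if $|t_n|\le C(1+|n|)^{-\alpha}$ for some constant $C$. A function on the unit circle is *gapped* if it is continuous and non-vanishing there; its winding number is the increase of a continuous choice of its argument along the circle, divided by $2\pi$. $(h(z))_k$ denotes the $k$-th Fourier coefficient of $h$ on the unit circle.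 **1. Critical chains.** Let $d=z_{\rm dyn}\ge 0$ be an integer, let $t$ be real and $\alpha$-decaying with $\alpha>d+1$, and suppose that on the unit circle $f_{\rm crit}(z)=\sum_n t_nz^n=(z-1)^{d}f_{\rm gap}(z)$, where $f_{\rm gap}$ is gapped with winding number $\omega$. Then: * $f_{\rm gap}(z)=\sum_n s_nz^n$ with real $(\alpha-d)$-decaying couplings $s_n$, and $z^{-\omega}f_{\rm gap}(z)$ has a continuous logarithm $V$ on the unit circle with absolutely summable Fourier coefficients $V_k$; with $b_\pm(z)=\exp\big(\sum_{k\ge1}V_{\pm k}z^{\pm k}\big)$ one has $f_{\rm gap}(z)=e^{V_0}z^\omega b_+(z)b_-(z)$. * If $\omega>0$, the critical half-infinite chain has the $\omega$ linearly independent localized real zero-energy edge modes $\sum_{n\ge0}g^{(m)}_n\gamma_n$, $g_n^{(m)}=\big(1/b_-(1/z)\big)_{n-m}$, $0\le m\le\omega-1$. The same modes are edge modes of each of the gapped chains with functions $z^jf_{\rm gap}(z)$, $0\le j\le d$. * If $\omega<-d$, the critical half-infinite chain has the $|\omega|-d$ linearly independent localized real zero-energy edge modes $\sum_{n\ge0}g^{(m)}_n\tilde\gamma_n$,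 $g_n^{(m)}=\big(1/b_+(z)\big)_{n-m}$, $0\le m\le|\omega|-d-1$. The same modes are edge modes of each of the gapped chains with functions $z^jf_{\rm gap}(z)$, $0\le j\le d$. **2. An interpolating example.** Let $\beta,\gamma>2$, let $\mathrm{Li}_s(z)=\sum_{k\ge1}z^k/k^s$ and $H^{(s)}_n=\sum_{m=1}^n m^{-s}$, and for real $a,\lambda$ put $$f_\lambda(z)=\lambda z\big(1+a\,\mathrm{Li}_\beta(z)\big)-(1-\lambda)\big(1+b\,\mathrm{Li}_\gamma(z)\big),\qquad b=a\,\frac{\zeta(\beta)}{\zeta(\gamma)},$$ $$f_g(z)=1-a\sum_{n\ge1}\Big(H^{(\beta)}_{n-1}-\frac{\zeta(\beta)}{\zeta(\gamma)}H^{(\gamma)}_n\Big)z^n .$$ For every real $a$ the couplings of $f_g$ are $(\min(\beta,\gamma)-1)$-decaying and $f_{1/2}(z)=\tfrac12(z-1)f_g(z)$ on the unit circle. Moreover there is $a_0>0$, depending only on $\beta,\gamma$, such that for all $|a|<a_0$: * $f_0$ and $f_1$ are gapped with winding numbers $0$ and $1$ respectively, and for real $\lambda$, $f_\lambda(1)=0$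 if and only if $\lambda=\frac12$; * $f_g$ is gapped with winding number $0$; * for every $\kappa\in\mathbb Z$ the function $z^\kappa f_{1/2}(z)$ has real $\min(\beta,\gamma)$-decaying couplings, and its half-infinite chain has: if $\kappa>0$, the $\kappa$ linearly independent exactly localized edge modes $\gamma_0,\dots,\gamma_{\kappa-1}$; if $\kappa<-1$, the $|\kappa|-1$ linearly independent localized edge modes $\sum_{n\ge0}g^{(m)}_n\tilde\gamma_n$ with $g_n^{(m)}=(1/f_g(z))_{n-m}$, $0\le m\le|\kappa|-2$, which are also edge modes of the gapped chains with functions $z^{\kappa}f_g(z)$ and $z^{\kappa+1}f_g(z)$. -/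

import Mathlib

open Filter Topology

noncomputable section

namespace BDI

/-! ### Couplings, symbols, Fourier coefficients, winding number -/

/-- The couplings `t` are `α`-decaying: `|t n| ≤ C (1 + |n|) ^ (-α)`. -/
def IsDecaying (α : ℝ) (t : ℤ → ℝ) : Prop :=
  ∃ C : ℝ, ∀ n : ℤ, |t n| ≤ C * (1 + |(n : ℝ)|) ^ (-α)

/-- The function `f(z) = ∑ₙ tₙ zⁿ` of a chain (used for absolutely summable `t` and `|z| = 1`). -/
def symbol (t : ℤ → ℝ) (z : ℂ) : ℂ := ∑' n : ℤ, (t n : ℂ) * z ^ n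

/-- The `k`-th Fourier coefficient `(2πi)⁻¹ ∮ h(z) z^{-(k+1)} dz` over the unit circle. -/
def coeff (h : ℂ → ℂ) (k : ℤ) : ℂ :=
  (2 * Real.pi * Complex.I)⁻¹ * ∮ z in C(0, 1), h z * z ^ (-(k + 1))

/-- `f` is continuous and non-vanishing on the unit circle. -/
def Gapped (f : ℂ → ℂ) : Prop :=
  ContinuousOn f (Metric.sphere 0 1) ∧ ∀ z : ℂ, ‖z‖ = 1 → f z ≠ 0

/-- A continuous choice `φ` of the argument of `f(e^{iθ})` increases by `2πω` on `[0, 2π]`. -/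
def HasWindingNumber (f : ℂ → ℂ) (ω : ℤ) : Prop :=
  ∃ φ : ℝ → ℝ, Continuous φ ∧
    (∀ θ : ℝ, f (Complex.exp (θ * Complex.I)) =
      ‖f (Complex.exp (θ * Complex.I))‖ * Complex.exp (φ θ * Complex.I)) ∧
    φ (2 * Real.pi) - φ 0 = 2 * Real.pi * ω

/-! ### Wiener–Hopf factors -/

/-- `V` is a continuous logarithm of `z^{-ω} f(z)` on the unit circle, and its Fourier
coefficients are absolutely summable. -/
structure IsWienerHopfLog (f : ℂ → ℂ) (ω : ℤ) (V : ℂ → ℂ) : Prop where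
  continuousOn : ContinuousOn V (Metric.sphere 0 1)
  exp_eq : ∀ z : ℂ, ‖z‖ = 1 → Complex.exp (V z) = z ^ (-ω) * f z
  summable : Summable fun k : ℤ => ‖coeff V k‖

/-- `b₊(z) = exp (∑_{k ≥ 1} V_k z^k)`. -/
def bPlus (V : ℂ → ℂ) (z : ℂ) : ℂ :=
  Complex.exp (∑' k : ℕ, coeff V ((k : ℤ) + 1) * z ^ (k + 1))

/-- `b₋(z) = exp (∑_{k ≥ 1} V_{-k} z^{-k})`. -/
def bMinus (V : ℂ → ℂ) (z : ℂ) : ℂ :=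
  Complex.exp (∑' k : ℕ, coeff V (-((k : ℤ) + 1)) * (z ^ (k + 1))⁻¹)

/-! ### Fermions on the half-infinite lattice `ℕ` -/

/-- Fermionic Fock space over the sites `ℕ`: the Hilbert space with orthonormal basis the
occupation states `|S⟩`, `S` a finite set of sites; `ψ S` is the amplitude of `|S⟩`. -/
abbrev Fock : Type := lp (fun _ : Finset ℕ => ℂ) 2

/-- Bounded operators on Fock space, with the operator norm. -/
abbrev Op : Type := Fock →L[ℂ] Fock

/-- The sign `(-1)^{#{k ∈ S : k < n}}`. -/
def jwSign (n : ℕ) (S : Finset ℕ) : ℂ := (-1) ^ (S.filter (· < n)).card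

/-- Amplitudes of `c_n ψ`, where `c_n |S ∪ {n}⟩ = (-1)^{#{k ∈ S : k < n}} |S⟩` for `n ∉ S`, and
`c_n |S⟩ = 0` for `n ∉ S`. -/
def annihFun (n : ℕ) (ψ : Finset ℕ → ℂ) (S : Finset ℕ) : ℂ :=
  if n ∈ S then 0 else jwSign n S * ψ (insert n S)

theorem sum_annihFun_le (n : ℕ) (ψ : Fock) (s : Finset (Finset ℕ)) :
    ∑ S ∈ s, ‖annihFun n ψ S‖ ^ (2 : ENNReal).toReal ≤ ‖ψ‖ ^ (2 : ENNReal).toReal := by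
  classical
  have h1 : ∑ S ∈ s, ‖annihFun n ψ S‖ ^ (2 : ENNReal).toReal =
      ∑ S ∈ s.filter (fun S => n ∉ S), ‖ψ (insert n S)‖ ^ (2 : ENNReal).toReal := by
    rw [Finset.sum_filter]
    refine Finset.sum_congr rfl fun S _ => ?_
    by_cases h : n ∈ S <;> simp [annihFun, jwSign, h]
  rw [h1, ← Finset.sum_image (f := fun S => ‖ψ S‖ ^ (2 : ENNReal).toReal) (g := fun S => insert n S)]
  · exact lp.sum_rpow_le_norm_rpow (by simp) ψ _
  · intro S hS T hT h
    simp only [Finset.coe_filter, Set.mem_ofPred_eq] at hS hT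
    have := congrArg (fun U => Finset.erase U n) h
    simpa [Finset.erase_insert hS.2, Finset.erase_insert hT.2] using this

/-- The fermionic annihilation operator `c_n`. -/
def annih (n : ℕ) : Op :=
  LinearMap.mkContinuous
    { toFun := fun ψ => ⟨annihFun n ψ, memℓp_gen' (sum_annihFun_le n ψ)⟩
      map_add' := fun ψ χ => by
        ext S
        change annihFun n (ψ + χ : Fock) S = annihFun n ψ S + annihFun n χ S
        by_cases h : n ∈ S <;> simp [annihFun, h, mul_add]
      map_smul' := fun a ψ => by
        ext S
        change annihFun n (a • ψ : Fock) S = a * annihFun n ψ S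
        by_cases h : n ∈ S <;> simp [annihFun, h, mul_left_comm] }
    1 fun ψ => by
      rw [one_mul]
      exact lp.norm_le_of_forall_sum_le (by simp) (norm_nonneg _) (sum_annihFun_le n ψ)

/-- The real Majorana operator `γ_n = c_n + c_n†`. -/
def majA (n : ℕ) : Op := annih n + ContinuousLinearMap.adjoint (annih n)

/-- The imaginary Majorana operator `γ̃_n = i (c_n† - c_n)`. -/
def majB (n : ℕ) : Op := Complex.I • (ContinuousLinearMap.adjoint (annih n) - annih n)

/-- The open chain on the sites `0, …, N - 1`: `(i/2) ∑_{m,n} t_{m-n} γ̃_n γ_m`. -/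
def ham (t : ℤ → ℝ) (N : ℕ) : Op :=
  (Complex.I / 2) • ∑ m ∈ Finset.range N, ∑ n ∈ Finset.range N,
    (t ((m : ℤ) - (n : ℤ)) : ℂ) • (majB n * majA m)

/-- `Γ = ∑ₙ gₙ χₙ` (with `χ` one of the two species of Majorana operators) is a normalisable real
zero-energy edge mode of the half-infinite open chain with couplings `t`. The formal Hamiltonian of
the half-infinite chain is the limit of the open chains on `{0, …, N - 1}`, and `[Γ, H] = 0` is the
vanishing of the limit, in operator norm, of the commutators. -/
structure IsEdgeMode (χ : ℕ → Op) (t : ℤ → ℝ) (g : ℕ → ℝ) (Γ : Op) : Prop where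
  normalisable : Summable fun n => g n ^ 2
  hasSum : HasSum (fun n => (g n : ℂ) • χ n) Γ
  zero_energy : Tendsto (fun N => Γ * ham t N - ham t N * Γ) atTop (𝓝 0)

/-- The wavefunctions `g i` give linearly independent edge modes of the half-infinite open chain
with couplings `t`. -/
def HasEdgeModes {ι : Type} (χ : ℕ → Op) (t : ℤ → ℝ) (g : ι → ℕ → ℝ) : Prop :=
  ∃ Γ : ι → Op, LinearIndependent ℂ Γ ∧ ∀ i, IsEdgeMode χ t (g i) (Γ i)

/-- The `N` real wavefunctions `g⁽ᵐ⁾ₙ = (h(z))_{n-m}`, `0 ≤ m < N`. -/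
def AreShiftedCoeffs {N : ℕ} (h : ℂ → ℂ) (g : Fin N → ℕ → ℝ) : Prop :=
  ∀ (m : Fin N) (n : ℕ), (g m n : ℂ) = coeff h ((n : ℤ) - ((m : ℕ) : ℤ))

/-- Couplings of `z^j f(z)`, if `s` are the couplings of `f(z)`. -/
def shift (j : ℤ) (s : ℤ → ℝ) (n : ℤ) : ℝ := s (n - j)

/-! ### The interpolating family of polylogarithmic chains -/

/-- The polylogarithm `∑_{k ≥ 1} z^k / k^s` (used for `|z| = 1` and `s > 1`). -/
def polylog (s : ℝ) (z : ℂ) : ℂ := ∑' k : ℕ, z ^ (k + 1) / ((((k : ℝ) + 1) ^ s : ℝ) : ℂ)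

/-- `ζ(s)` for real `s > 1`. -/
def zetaReal (s : ℝ) : ℝ := (riemannZeta (s : ℂ)).re

/-- The generalised harmonic number `∑_{1 ≤ m ≤ n} m^{-s}`. -/
def harmonicNumber (s : ℝ) (n : ℕ) : ℝ := ∑ m ∈ Finset.Icc 1 n, (m : ℝ) ^ (-s)

/-- `λ z (1 + a Li_β(z)) - (1 - λ) (1 + b Li_γ(z))` with `b = a ζ(β) / ζ(γ)`. -/
def interp (a β γ lam : ℝ) (z : ℂ) : ℂ :=
  lam * z * (1 + a * polylog β z) -
    (1 - lam) * (1 + (a * (zetaReal β / zetaReal γ) : ℝ) * polylog γ z)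

/-- The couplings of `f_g(z) = 1 - a ∑_{n ≥ 1} (H_{n-1}^{(β)} - (ζ(β)/ζ(γ)) H_n^{(γ)}) z^n`. -/
def gapCoupling (a β γ : ℝ) (n : ℤ) : ℝ :=
  if n < 0 then 0 else if n = 0 then 1 else
    -a * (harmonicNumber β (n.toNat - 1) -
      zetaReal β / zetaReal γ * harmonicNumber γ n.toNat)

end BDI

end

namespace BDI

/-! ### Absolutely convergent Laurent series on the unit circle -/

/-! Everything takes place in the Wiener algebra of absolutely convergent Laurent series on the
circle, with control of which exponents occur.

By the Majorana anticommutation relations, `[Γ, H] = 0` for an absolutely summable `g` becomes a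
half-line Toeplitz equation: the nonnegative coefficients of `F(z) · g(z)` vanish, with `F` the
symbol of the chain for `γ̃` modes and `F(1/z)` for `γ` modes. If `h` has only exponents `≥ 0` and
`F h` only exponents `≤ L`, then `z^m h` is a solution for every `m` with `L + m < 0`
(`tsum_toeplitz_eq_zero`). These solutions are triangular with nonzero diagonal, hence independent
(`hasEdgeModes_of_triangular`).

For `F = P f_gap` with `f_gap = e^{V₀} z^ω b₊ b₋`, take `h = 1/b₊`: what remains is `P z^ω b₋` up to
a constant, with exponents at most `deg P + ω`. In the reflected case `h = 1/b₋(1/z)` leaves `P(1/z)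
z^{-ω} b₊(1/z)`, with exponents at most `-ω`. So `(z-1)^d` costs `d` modes of the `γ̃` species and
none of the `γ` species. A factor `z^j` with `0 ≤ j ≤ d` obeys the same exponent bounds as
`(z-1)^d`, and therefore the gapped chains share the modes.

Two analytic inputs are needed. A Wiener–Lévy theorem (`exists_wiener_log`) gives `V` absolutely
summable coefficients: a trigonometric polynomial close to the continuous logarithm reduces the
problem to `log(1 + h)` with `|h| ≤ 1/2`, and the powers of `h` decay geometrically in the Wiener
norm too. Division by `z - 1` (`IsDecaying.exists_antidifference`) replaces couplings of zero sum by
their tail sums, at the cost of one order of decay.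

In the example, `b = a ζ(β)/ζ(γ)` puts the zero of `f_{1/2}` at `z = 1`, the quotient is found by
summation by parts, and `f_g = 1 + a x` with `x` independent of `a`. For small `a` a Neumann series
inverts `f_g` within exponents `≥ 0`, so `f_g` itself plays the role of `b₊`. -/

/-- `h(z) = ∑ₖ cₖ zᵏ` on the unit circle, with absolutely summable `c`. -/
structure IsFourier (c : ℤ → ℂ) (h : ℂ → ℂ) : Prop where
  summable : Summable fun k => ‖c k‖
  eq_tsum : ∀ z : ℂ, ‖z‖ = 1 → h z = ∑' k : ℤ, c k * z ^ k

theorem ne_zero_of_norm_one {z : ℂ} (hz : ‖z‖ = 1) : z ≠ 0 := by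
  rintro rfl; simp at hz

theorem norm_mul_zpow {z : ℂ} (hz : ‖z‖ = 1) (a : ℂ) (k : ℤ) : ‖a * z ^ k‖ = ‖a‖ := by
  simp [norm_zpow, hz]

theorem IsFourier.hasSum {c : ℤ → ℂ} {h : ℂ → ℂ} (H : IsFourier c h) {z : ℂ} (hz : ‖z‖ = 1) :
    HasSum (fun k => c k * z ^ k) (h z) := by
  rw [H.eq_tsum z hz]
  refine Summable.hasSum (Summable.of_norm ?_)
  simpa only [norm_mul_zpow hz] using H.summable

theorem IsFourier.of_hasSum {c : ℤ → ℂ} {h : ℂ → ℂ} (hc : Summable fun k => ‖c k‖)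
    (H : ∀ z : ℂ, ‖z‖ = 1 → HasSum (fun k => c k * z ^ k) (h z)) : IsFourier c h :=
  ⟨hc, fun z hz => (H z hz).tsum_eq.symm⟩

theorem IsFourier.congr {c : ℤ → ℂ} {h h' : ℂ → ℂ} (H : IsFourier c h)
    (e : ∀ z : ℂ, ‖z‖ = 1 → h' z = h z) : IsFourier c h' :=
  ⟨H.summable, fun z hz => (e z hz).trans (H.eq_tsum z hz)⟩

theorem IsFourier.norm_le {c : ℤ → ℂ} {h : ℂ → ℂ} (H : IsFourier c h) {z : ℂ} (hz : ‖z‖ = 1) :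
    ‖h z‖ ≤ ∑' k, ‖c k‖ := by
  rw [H.eq_tsum z hz]
  refine (norm_tsum_le_tsum_norm ?_).trans_eq ?_ <;> simp only [norm_mul_zpow hz]
  exact H.summable

theorem IsFourier.continuousOn {c : ℤ → ℂ} {h : ℂ → ℂ} (H : IsFourier c h) :
    ContinuousOn h (Metric.sphere 0 1) := by
  have : ContinuousOn (fun z : ℂ => ∑' k : ℤ, c k * z ^ k) (Metric.sphere 0 1) := by
    refine continuousOn_tsum (u := fun k => ‖c k‖) (fun k => ?_) H.summable fun k z hz => ?_
    · refine continuousOn_const.mul fun z hz => ContinuousAt.continuousWithinAt ?_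
      exact continuousAt_zpow₀ z k (Or.inl (ne_zero_of_norm_one (by simpa using hz)))
    · exact (norm_mul_zpow (by simpa using hz) _ _).le
  exact this.congr fun z hz => H.eq_tsum z (by simpa using hz)

theorem norm_coeff_le {h : ℂ → ℂ} {s : ℝ} (hs : ∀ z : ℂ, ‖z‖ = 1 → ‖h z‖ ≤ s) (k : ℤ) :
    ‖coeff h k‖ ≤ s := by
  have := circleIntegral.norm_two_pi_i_inv_smul_integral_le_of_norm_le_const
    (f := fun z => h z * z ^ (-(k + 1))) (c := 0) (R := 1) (C := s) zero_le_one fun z hz => by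
      have hz' : ‖z‖ = 1 := by simpa using hz
      rw [norm_mul_zpow hz']
      exact hs z hz'
  simpa [coeff] using this

theorem coeff_zpow (j k : ℤ) : coeff (fun z => z ^ j) k = if j = k then 1 else 0 := by
  have h1 : (∮ z in C(0, 1), z ^ j * z ^ (-(k + 1))) = ∮ z in C(0, 1), (z - 0) ^ (j - k - 1) := by
    refine circleIntegral.integral_congr zero_le_one fun z hz => ?_
    have hz0 : z ≠ 0 := ne_zero_of_norm_one (by simpa using hz)
    simp only [sub_zero, ← zpow_add₀ hz0]
    congr 1; ring
  unfold coeff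
  rw [h1]
  split_ifs with h
  · subst h
    have : (∮ z in C(0, 1), (z - 0 : ℂ) ^ (j - j - 1)) = 2 * Real.pi * Complex.I := by
      simpa using circleIntegral.integral_sub_center_inv 0 (one_ne_zero (α := ℝ))
    rw [this, inv_mul_cancel₀ Complex.two_pi_I_ne_zero]
  · rw [circleIntegral.integral_sub_zpow_of_ne (by omega), mul_zero]

/-- Termwise integration, dominated by the summable `‖c j‖`. It makes Laurent coefficients unique,
so that computing one coefficient in two ways yields equations. -/
theorem IsFourier.coeff_eq {c : ℤ → ℂ} {h : ℂ → ℂ} (H : IsFourier c h) (k : ℤ) :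
    coeff h k = c k := by
  have key : HasSum (fun j => c j * coeff (fun z => z ^ j) k) (coeff h k) := by
    have h1 : HasSum (fun j => ∮ z in C(0, 1), c j * (z ^ j * z ^ (-(k + 1))))
        (∮ z in C(0, 1), h z * z ^ (-(k + 1))) := by
      unfold circleIntegral
      have hu : ∀ θ : ℝ, ‖circleMap 0 1 θ‖ = 1 := fun θ => by simp
      have hc : ∀ j : ℤ, Continuous fun θ : ℝ => circleMap 0 1 θ ^ j := fun j =>
        (continuous_circleMap 0 1).zpow₀ j fun θ => Or.inl (ne_zero_of_norm_one (hu θ))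
      refine intervalIntegral.hasSum_integral_of_dominated_convergence (fun j _ => ‖c j‖)
        (fun j => ?_) (fun j => ?_) ?_ ?_ ?_
      · refine Continuous.aestronglyMeasurable ?_
        simp only [deriv_circleMap]
        exact ((continuous_circleMap 0 1).mul continuous_const).smul
          (continuous_const.mul ((hc j).mul (hc _)))
      · refine Eventually.of_forall fun θ _ => ?_
        simp [norm_zpow]
      · exact Eventually.of_forall fun θ _ => H.summable
      · exact intervalIntegrable_const
      · refine Eventually.of_forall fun θ _ => ?_
        refine HasSum.const_smul _ ?_
        simpa only [mul_assoc] using (H.hasSum (hu θ)).mul_right (circleMap 0 1 θ ^ (-(k + 1)))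
    have h2 := h1.mul_left (2 * Real.pi * Complex.I : ℂ)⁻¹
    convert! h2 using 2 with j
    unfold coeff
    rw [circleIntegral.integral_const_mul]
    ring
  simp only [coeff_zpow, mul_ite, mul_one, mul_zero] at key
  refine key.unique ?_
  convert! hasSum_ite_eq k (c k) using 2 with j
  split_ifs with hj <;> simp [hj]

theorem IsFourier.unique {c c' : ℤ → ℂ} {h : ℂ → ℂ} (H : IsFourier c h) (H' : IsFourier c' h) :
    c = c' :=
  funext fun k => (H.coeff_eq k).symm.trans (H'.coeff_eq k)

theorem IsFourier.add {c c' : ℤ → ℂ} {h h' : ℂ → ℂ} (H : IsFourier c h) (H' : IsFourier c' h') :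
    IsFourier (fun k => c k + c' k) (fun z => h z + h' z) := by
  refine .of_hasSum (.of_nonneg_of_le (fun _ => norm_nonneg _) (fun k => norm_add_le _ _)
    (H.summable.add H'.summable)) fun z hz => ?_
  simpa only [add_mul] using (H.hasSum hz).add (H'.hasSum hz)

theorem IsFourier.const_mul {c : ℤ → ℂ} {h : ℂ → ℂ} (H : IsFourier c h) (a : ℂ) :
    IsFourier (fun k => a * c k) (fun z => a * h z) := by
  refine .of_hasSum ?_ fun z hz => ?_
  · simpa only [norm_mul] using H.summable.mul_left ‖a‖
  · simpa only [mul_assoc] using (H.hasSum hz).mul_left a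

theorem IsFourier.zpow_mul {c : ℤ → ℂ} {h : ℂ → ℂ} (H : IsFourier c h) (j : ℤ) :
    IsFourier (fun k => c (k - j)) (fun z => z ^ j * h z) := by
  refine .of_hasSum ?_ fun z hz => ?_
  · exact (Equiv.subRight j).summable_iff.mpr H.summable
  · have := (Equiv.subRight j).hasSum_iff.mpr ((H.hasSum hz).mul_left (z ^ j))
    convert! this using 2 with k
    have hz0 := ne_zero_of_norm_one hz
    simp only [Function.comp, Equiv.subRight_apply]
    rw [mul_left_comm, ← zpow_add₀ hz0]
    congr 2; ring

theorem IsFourier.inv_arg {c : ℤ → ℂ} {h : ℂ → ℂ} (H : IsFourier c h) :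
    IsFourier (fun k => c (-k)) (fun z => h (1 / z)) := by
  refine .of_hasSum ((Equiv.neg ℤ).summable_iff.mpr H.summable) fun z hz => ?_
  have := (Equiv.neg ℤ).hasSum_iff.mpr (H.hasSum (z := 1 / z) (by simp [hz]))
  convert! this using 2 with k
  simp

theorem IsFourier.conj {c : ℤ → ℂ} {h : ℂ → ℂ} (H : IsFourier c h) :
    IsFourier (fun k => (starRingEnd ℂ) (c k))
      (fun z => (starRingEnd ℂ) (h ((starRingEnd ℂ) z))) := by
  refine .of_hasSum (by simpa using H.summable) fun z hz => ?_
  have := (H.hasSum (z := (starRingEnd ℂ) z) (by simpa using hz)).star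
  simpa [mul_comm] using this

theorem IsFourier.mul {c c' : ℤ → ℂ} {h h' : ℂ → ℂ} (H : IsFourier c h) (H' : IsFourier c' h') :
    IsFourier (fun k => ∑' j, c j * c' (k - j)) (fun z => h z * h' z) ∧
      ∑' k, ‖∑' j, c j * c' (k - j)‖ ≤ (∑' k, ‖c k‖) * ∑' k, ‖c' k‖ := by
  -- The pair (total exponent `k`, first exponent `j`) goes to `(j, k - j)`, so summing the double
  -- series over fibres of `k` gives the convolution.
  let e : ℤ × ℤ ≃ ℤ × ℤ :=
    { toFun := fun p => (p.2, p.1 - p.2)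
      invFun := fun p => (p.1 + p.2, p.1)
      left_inv := fun p => by ext <;> simp
      right_inv := fun p => by ext <;> simp }
  have hn : HasSum (fun p : ℤ × ℤ => ‖c p.2 * c' (p.1 - p.2)‖)
      ((∑' k, ‖c k‖) * ∑' k, ‖c' k‖) := by
    have h1 : Summable fun p : ℤ × ℤ => ‖c p.1‖ * ‖c' p.2‖ :=
      H.summable.mul_of_nonneg H'.summable (fun _ => norm_nonneg _) fun _ => norm_nonneg _
    have h2 := e.hasSum_iff.mpr (H.summable.hasSum.mul H'.summable.hasSum h1)
    simpa only [norm_mul] using! h2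
  have hfib : ∀ k : ℤ, Summable fun j => ‖c j * c' (k - j)‖ := fun k => hn.summable.prod_factor k
  have hrow := hn.summable.prod
  have hle : ∀ k : ℤ, ‖∑' j, c j * c' (k - j)‖ ≤ ∑' j, ‖c j * c' (k - j)‖ := fun k =>
    norm_tsum_le_tsum_norm (hfib k)
  have hS : Summable fun k : ℤ => ‖∑' j, c j * c' (k - j)‖ :=
    .of_nonneg_of_le (fun _ => norm_nonneg _) hle hrow
  refine ⟨.of_hasSum hS fun z hz => ?_, ?_⟩
  · have hz0 := ne_zero_of_norm_one hz
    have h3 : Summable fun p : ℤ × ℤ => (c p.1 * z ^ p.1) * (c' p.2 * z ^ p.2) := by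
      refine summable_mul_of_summable_norm (f := fun k => c k * z ^ k) (g := fun k => c' k * z ^ k)
        ?_ ?_ <;> simp only [norm_mul_zpow hz]
      exacts [H.summable, H'.summable]
    have h4 := e.hasSum_iff.mpr ((H.hasSum hz).mul (H'.hasSum hz) h3)
    have h5 : HasSum (fun p : ℤ × ℤ => (c p.2 * c' (p.1 - p.2)) * z ^ p.1) (h z * h' z) := by
      convert! h4 using 2 with p
      simp only [Function.comp, e, Equiv.coe_fn_mk]
      rw [mul_mul_mul_comm, ← zpow_add₀ hz0, add_sub_cancel]
    have h6 : ∀ k : ℤ, HasSum (fun j => c j * c' (k - j)) (∑' j, c j * c' (k - j)) := fun k =>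
      (Summable.of_norm (f := fun j => c j * c' (k - j)) (hfib k)).hasSum
    exact h5.prod_fiberwise fun k => (h6 k).mul_right (z ^ k)
  · rw [← hn.tsum_eq, hn.summable.tsum_prod]
    exact hS.tsum_le_tsum hle hrow

/-! ### The Wiener algebra with prescribed exponents -/

/-- `h` is on the unit circle a Laurent series with exponents in `M` whose coefficients have
absolute sum at most `r`. -/
def Wiener (M : Set ℤ) (h : ℂ → ℂ) (r : ℝ) : Prop :=
  ∃ c : ℤ → ℂ, IsFourier c h ∧ (∀ k, k ∉ M → c k = 0) ∧ ∑' k, ‖c k‖ ≤ r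

namespace Wiener

variable {M M' : Set ℤ} {h h' : ℂ → ℂ} {r r' : ℝ}

theorem mono (H : Wiener M h r) (hM : M ⊆ M') (hr : r ≤ r') : Wiener M' h r' := by
  obtain ⟨c, h1, h2, h3⟩ := H
  exact ⟨c, h1, fun k hk => h2 k fun h => hk (hM h), h3.trans hr⟩

theorem congr (H : Wiener M h r) (e : ∀ z : ℂ, ‖z‖ = 1 → h' z = h z) : Wiener M h' r := by
  obtain ⟨c, h1, h2, h3⟩ := H
  exact ⟨c, h1.congr e, h2, h3⟩

theorem isFourier (H : Wiener M h r) : IsFourier (coeff h) h := by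
  obtain ⟨c, h1, h2, h3⟩ := H
  rwa [show coeff h = c from funext h1.coeff_eq]

theorem coeff_eq_zero (H : Wiener M h r) {k : ℤ} (hk : k ∉ M) : coeff h k = 0 := by
  obtain ⟨c, h1, h2, h3⟩ := H
  rw [h1.coeff_eq, h2 k hk]

theorem norm_le (H : Wiener M h r) {z : ℂ} (hz : ‖z‖ = 1) : ‖h z‖ ≤ r := by
  obtain ⟨c, h1, h2, h3⟩ := H
  exact (h1.norm_le hz).trans h3

theorem nonneg (H : Wiener M h r) : 0 ≤ r := by
  obtain ⟨c, h1, h2, h3⟩ := H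
  exact (tsum_nonneg fun _ => norm_nonneg _).trans h3

theorem add (H : Wiener M h r) (H' : Wiener M h' r') : Wiener M (fun z => h z + h' z) (r + r') := by
  obtain ⟨c, h1, h2, h3⟩ := H
  obtain ⟨c', h1', h2', h3'⟩ := H'
  refine ⟨_, h1.add h1', fun k hk => by simp [h2 k hk, h2' k hk], ?_⟩
  refine ((h1.add h1').summable.tsum_le_tsum (fun k => norm_add_le _ _)
    (h1.summable.add h1'.summable)).trans ?_
  rw [h1.summable.tsum_add h1'.summable]
  exact add_le_add h3 h3'

theorem const_mul (H : Wiener M h r) (a : ℂ) : Wiener M (fun z => a * h z) (‖a‖ * r) := by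
  obtain ⟨c, h1, h2, h3⟩ := H
  refine ⟨_, h1.const_mul a, fun k hk => by simp [h2 k hk], ?_⟩
  simp only [norm_mul, tsum_mul_left]
  exact mul_le_mul_of_nonneg_left h3 (norm_nonneg _)

theorem mul (H : Wiener M h r) (H' : Wiener M' h' r') :
    Wiener (Set.image2 (· + ·) M M') (fun z => h z * h' z) (r * r') := by
  have hr := H.nonneg
  obtain ⟨c, h1, h2, h3⟩ := H
  obtain ⟨c', h1', h2', h3'⟩ := H'
  refine ⟨_, (h1.mul h1').1, fun k hk => ?_, (h1.mul h1').2.trans ?_⟩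
  · rw [← tsum_zero (β := ℤ)]
    congr 1 with j
    by_cases hj : j ∈ M
    · have : k - j ∉ M' := fun h => hk ⟨j, hj, k - j, h, by simp⟩
      simp [h2' _ this]
    · simp [h2 j hj]
  · exact mul_le_mul h3 h3' (tsum_nonneg fun _ => norm_nonneg _) hr

theorem monomial (j : ℤ) : Wiener {j} (fun z => z ^ j) 1 := by
  refine ⟨fun k => if k = j then 1 else 0, .of_hasSum ?_ fun z _ => ?_, fun k hk => ?_, ?_⟩
  · refine summable_of_ne_finset_zero (s := {j}) fun k hk => ?_
    simp at hk; simp [hk]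
  · convert! hasSum_ite_eq j (z ^ j) using 2 with k
    split_ifs with h <;> simp [h]
  · simpa using hk
  · rw [tsum_eq_single j (fun k hk => by simp [hk])]; simp

theorem const (a : ℂ) (hM : (0 : ℤ) ∈ M) : Wiener M (fun _ => a) ‖a‖ := by
  refine (((monomial 0).const_mul a).mono (by simpa using hM) (by simp)).congr ?_
  intro z _; simp

/-- Completeness of the algebra: the double family of coefficients is absolutely summable by `ρ`, so
the two sums may be exchanged. Power series in an element can then be formed without leaving the
exponent set `M`. -/
theorem tsum {f : ℕ → ℂ → ℂ} {ρ : ℕ → ℝ} (H : ∀ n, Wiener M (f n) (ρ n)) (hρ : Summable ρ) :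
    Wiener M (fun z => ∑' n, f n z) (∑' n, ρ n) := by
  choose c h1 h2 h3 using H
  have hs : Summable fun p : ℕ × ℤ => ‖c p.1 p.2‖ := by
    refine (summable_prod_of_nonneg fun _ => norm_nonneg _).mpr ⟨fun n => (h1 n).summable, ?_⟩
    exact .of_nonneg_of_le (fun n => tsum_nonneg fun _ => norm_nonneg _) h3 hρ
  have hs' : Summable fun p : ℤ × ℕ => ‖c p.2 p.1‖ := hs.prod_symm
  have hle : ∀ k : ℤ, ‖∑' n, c n k‖ ≤ ∑' n, ‖c n k‖ := fun k =>
    norm_tsum_le_tsum_norm (hs'.prod_factor k)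
  have hS : Summable fun k : ℤ => ‖∑' n, c n k‖ :=
    .of_nonneg_of_le (fun _ => norm_nonneg _) hle hs'.prod
  refine ⟨fun k => ∑' n, c n k, .of_hasSum hS fun z hz => ?_, fun k hk => ?_, ?_⟩
  · have h4 : Summable fun p : ℕ × ℤ => c p.1 p.2 * z ^ p.2 := by
      refine Summable.of_norm ?_
      simpa only [norm_mul_zpow hz] using hs
    have h5 : HasSum (fun p : ℤ × ℕ => c p.2 p.1 * z ^ p.1) (∑' n, f n z) := by
      have h6 := h4.hasSum
      rw [h4.tsum_prod] at h6
      simp only [← (h1 _).eq_tsum z hz] at h6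
      exact (Equiv.prodComm ℤ ℕ).hasSum_iff.mpr h6
    have h7 : ∀ k : ℤ, HasSum (fun n => c n k) (∑' n, c n k) := fun k =>
      (Summable.of_norm (f := fun n => c n k) (hs'.prod_factor k)).hasSum
    exact h5.prod_fiberwise fun k => (h7 k).mul_right (z ^ k)
  · simp [h2 _ k hk]
  · refine (hS.tsum_le_tsum hle hs'.prod).trans ?_
    rw [← hs'.tsum_prod, ← (Equiv.prodComm ℕ ℤ).tsum_eq]
    simp only [Equiv.prodComm_apply, Prod.fst_swap, Prod.snd_swap]
    rw [hs.tsum_prod]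
    exact hs.prod.tsum_le_tsum h3 hρ

theorem mul_of_add_mem (H : Wiener M h r) (H' : Wiener M h' r')
    (hadd : ∀ a ∈ M, ∀ b ∈ M, a + b ∈ M) : Wiener M (fun z => h z * h' z) (r * r') :=
  (H.mul H').mono (Set.image2_subset_iff.mpr hadd) le_rfl

theorem pow (H : Wiener M h r) (h0 : (0 : ℤ) ∈ M) (hadd : ∀ a ∈ M, ∀ b ∈ M, a + b ∈ M) (n : ℕ) :
    Wiener M (fun z => h z ^ n) (r ^ n) := by
  induction n with
  | zero => simpa using const 1 h0
  | succ n ih => simpa only [pow_succ] using ih.mul_of_add_mem H hadd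

theorem exp (H : Wiener M h r) (h0 : (0 : ℤ) ∈ M) (hadd : ∀ a ∈ M, ∀ b ∈ M, a + b ∈ M) :
    ∃ R, Wiener M (fun z => Complex.exp (h z)) R := by
  refine ⟨_, (tsum (f := fun n z => (n.factorial : ℂ)⁻¹ * h z ^ n)
    (fun n => (H.pow h0 hadd n).const_mul _) ?_).congr fun z _ => ?_⟩
  · simpa [div_eq_inv_mul] using Real.summable_pow_div_factorial r
  · rw [Complex.exp_eq_exp_ℂ, NormedSpace.exp_eq_tsum ℂ]
    simp

theorem one_sub_inv (H : Wiener M h r) (h0 : (0 : ℤ) ∈ M) (hadd : ∀ a ∈ M, ∀ b ∈ M, a + b ∈ M)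
    (hr : r < 1) : ∃ R, Wiener M (fun z => 1 / (1 - h z)) R := by
  refine ⟨_, (tsum (f := fun n z => h z ^ n) (fun n => H.pow h0 hadd n)
    (summable_geometric_of_lt_one H.nonneg hr)).congr fun z hz => ?_⟩
  rw [tsum_geometric_of_norm_lt_one ((H.norm_le hz).trans_lt hr), one_div]

end Wiener

/-! ### Logarithms in the algebra of absolutely convergent Laurent series -/

theorem exp_mul_I_surj {z : ℂ} (hz : ‖z‖ = 1) :
    ∃ θ ∈ Set.Ico 0 (2 * Real.pi), Complex.exp ((θ : ℝ) * Complex.I) = z := by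
  have h := Complex.norm_mul_exp_arg_mul_I z
  rw [hz, Complex.ofReal_one, one_mul] at h
  have h1 := Complex.neg_pi_lt_arg z
  have h2 := Complex.arg_le_pi z
  have h3 := Real.pi_pos
  rcases le_or_gt 0 z.arg with h0 | h0
  · exact ⟨z.arg, ⟨h0, by linarith⟩, h⟩
  · refine ⟨z.arg + 2 * Real.pi, ⟨by linarith, by linarith⟩, ?_⟩
    rw [← h]
    push_cast
    rw [h, add_mul, Complex.exp_add, h, Complex.exp_two_pi_mul_I, mul_one]

namespace Wiener

variable {M M' : Set ℤ} {h h' : ℂ → ℂ} {r r' : ℝ}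

theorem of_isFourier {c : ℤ → ℂ} (H : IsFourier c h) : Wiener Set.univ h (∑' k, ‖c k‖) :=
  ⟨c, H, fun k hk => absurd (Set.mem_univ k) hk, le_rfl⟩

theorem finset_sum {ι : Type*} (s : Finset ι) {f : ι → ℂ → ℂ} {ρ : ι → ℝ} (h0 : (0 : ℤ) ∈ M)
    (H : ∀ i ∈ s, Wiener M (f i) (ρ i)) : Wiener M (fun z => ∑ i ∈ s, f i z) (∑ i ∈ s, ρ i) := by
  classical
  induction s using Finset.induction_on with
  | empty => simpa using const 0 h0
  | insert a s ha ih =>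
    simp only [Finset.sum_insert ha]
    exact (H a (Finset.mem_insert_self a s)).add
      (ih fun i hi => H i (Finset.mem_insert_of_mem hi))

theorem exists_trig_approx (H : Wiener M h r) {ε : ℝ} (hε : 0 < ε) :
    ∃ (N : ℕ) (p y : ℂ → ℂ), Wiener (Set.Icc (-(N : ℤ)) N) p r ∧ Wiener Set.univ y ε ∧
      ∀ z : ℂ, ‖z‖ = 1 → h z = p z + y z := by
  obtain ⟨c, h1, -, h3⟩ := H
  obtain ⟨s, hs⟩ := ((tendsto_tsum_compl_atTop_zero fun k => ‖c k‖).eventually_lt_const hε).exists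
  obtain ⟨N, hN⟩ : ∃ N : ℕ, ∀ k ∈ s, k.natAbs ≤ N :=
    ⟨s.sup Int.natAbs, fun k hk => Finset.le_sup (f := Int.natAbs) hk⟩
  set J : Set ℤ := Set.Icc (-(N : ℤ)) N with hJ
  have hsJ : ∀ k, k ∉ J → k ∉ s := fun k hk hks => hk (by
    have := hN k hks
    rw [hJ, Set.mem_Icc]; omega)
  have hle : ∀ (A : Set ℤ) (k : ℤ), ‖A.indicator c k‖ ≤ ‖c k‖ := fun A k =>
    norm_indicator_le_norm_self _ _
  have hsum : ∀ A : Set ℤ, Summable fun k => ‖A.indicator c k‖ := fun A =>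
    .of_nonneg_of_le (fun _ => norm_nonneg _) (hle A) h1.summable
  have hF : ∀ A : Set ℤ, IsFourier (A.indicator c) fun z => ∑' k, A.indicator c k * z ^ k :=
    fun A => ⟨hsum A, fun z _ => rfl⟩
  refine ⟨N, _, _, ⟨_, hF J, fun k hk => Set.indicator_of_notMem hk c, ?_⟩,
    ⟨_, hF Jᶜ, fun k hk => absurd (Set.mem_univ k) hk, ?_⟩, fun z hz => ?_⟩
  · exact ((hsum J).tsum_le_tsum (hle J) h1.summable).trans h3
  · refine le_trans ?_ hs.le
    rw [show (∑' a : { x // x ∉ s }, ‖c a‖) = ∑' k, ({x | x ∉ s} : Set ℤ).indicator (‖c ·‖) k from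
      tsum_subtype {x : ℤ | x ∉ s} fun k => ‖c k‖]
    refine (hsum Jᶜ).tsum_le_tsum (fun k => ?_) (h1.summable.indicator _)
    by_cases hk : k ∈ J
    · rw [Set.indicator_of_notMem (not_not.mpr hk), norm_zero]
      exact Set.indicator_nonneg (fun _ _ => norm_nonneg _) _
    · rw [Set.indicator_of_mem hk, Set.indicator_of_mem (hsJ k hk)]
  · rw [← (hF J).eq_tsum z hz]
    have := ((hF J).add (hF Jᶜ)).eq_tsum z hz
    simp only [Set.indicator_self_add_compl_apply] at this
    rw [h1.eq_tsum z hz, ← this]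

theorem trig_pow {N : ℕ} (H : Wiener (Set.Icc (-(N : ℤ)) N) h r) (n : ℕ) :
    Wiener (Set.Icc (-((N * n : ℕ) : ℤ)) (N * n : ℕ)) (fun z => h z ^ n) (r ^ n) := by
  induction n with
  | zero => simpa using const (M := {0}) 1 rfl
  | succ n ih =>
    simp only [pow_succ]
    refine (ih.mul H).mono ?_ le_rfl
    rintro _ ⟨a, ha, b, hb, rfl⟩
    simp only [Set.mem_Icc] at *
    push_cast at *
    constructor <;> linarith

/-- There are at most `2L + 1` coefficients, each bounded by the sup norm. This is how the sup norm
comes to control the Wiener norm. -/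
theorem trig_of_norm_le {L : ℕ} {s : ℝ} (H : Wiener (Set.Icc (-(L : ℤ)) L) h r)
    (hs : ∀ z : ℂ, ‖z‖ = 1 → ‖h z‖ ≤ s) : Wiener Set.univ h ((2 * L + 1) * s) := by
  refine ⟨_, H.isFourier, fun k hk => absurd (Set.mem_univ k) hk, ?_⟩
  rw [tsum_eq_sum (s := Finset.Icc (-(L : ℤ)) L) fun k hk => by
    rw [H.coeff_eq_zero (by simpa using hk), norm_zero]]
  refine (Finset.sum_le_card_nsmul _ _ s fun k _ => norm_coeff_le hs k).trans_eq ?_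
  rw [Int.card_Icc, nsmul_eq_mul]
  congr 1
  rw [show ((L : ℤ) + 1 - -L).toNat = 2 * L + 1 by omega]
  push_cast; ring

/-- A spectral radius estimate: the Wiener norm of `h` may be large, but that of `h ^ n` decays
geometrically. Split `h = p + y` with `p` a trigonometric polynomial and `y` of Wiener norm at most
`1/8`. Then `|p| ≤ 1/2 + 1/8 = 5/8`, the degree of `p ^ k` grows only linearly, and the binomial
theorem gives the rate `5/8 + 1/8 = 3/4`. -/
theorem exists_pow_bound (H : Wiener Set.univ h r) (hs : ∀ z : ℂ, ‖z‖ = 1 → ‖h z‖ ≤ 1 / 2) :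
    ∃ N : ℕ, ∀ n : ℕ, Wiener Set.univ (fun z => h z ^ n) ((2 * (N * n : ℕ) + 1) * (3 / 4) ^ n) := by
  obtain ⟨N, p, y, hp, hy, e⟩ := H.exists_trig_approx (ε := 1 / 8) (by norm_num)
  have hps : ∀ z : ℂ, ‖z‖ = 1 → ‖p z‖ ≤ 5 / 8 := fun z hz => by
    have h1 : p z = h z - y z := by rw [e z hz]; ring
    rw [h1]
    linarith [norm_sub_le (h z) (y z), hs z hz, hy.norm_le hz]
  have hadd : ∀ a ∈ (Set.univ : Set ℤ), ∀ b ∈ (Set.univ : Set ℤ), a + b ∈ (Set.univ : Set ℤ) :=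
    fun _ _ _ _ => Set.mem_univ _
  refine ⟨N, fun n => ?_⟩
  have hterm : ∀ k ∈ Finset.range (n + 1),
      Wiener Set.univ (fun z => (n.choose k : ℂ) * (p z ^ k * y z ^ (n - k)))
        ((2 * (N * n : ℕ) + 1) * ((5 / 8) ^ k * (1 / 8) ^ (n - k) * n.choose k)) := fun k hk => by
    have hk' : k ≤ n := Nat.lt_succ_iff.mp (Finset.mem_range.mp hk)
    have h1 := (hp.trig_pow k).trig_of_norm_le (s := (5 / 8) ^ k) fun z hz => by
      rw [norm_pow]; exact pow_le_pow_left₀ (norm_nonneg _) (hps z hz) k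
    have h2 := (h1.mul_of_add_mem (hy.pow (Set.mem_univ _) hadd (n - k)) hadd).const_mul
      (n.choose k : ℂ)
    refine h2.mono le_rfl ?_
    rw [Complex.norm_natCast]
    have h3 : (2 * ((N * k : ℕ) : ℝ) + 1) ≤ 2 * (N * n : ℕ) + 1 := by
      have : ((N * k : ℕ) : ℝ) ≤ (N * n : ℕ) := by exact_mod_cast Nat.mul_le_mul_left N hk'
      linarith
    calc (n.choose k : ℝ) * ((2 * ((N * k : ℕ) : ℝ) + 1) * (5 / 8) ^ k * (1 / 8) ^ (n - k))
        = (2 * ((N * k : ℕ) : ℝ) + 1) * ((5 / 8) ^ k * (1 / 8) ^ (n - k) * n.choose k) := by ring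
      _ ≤ _ := mul_le_mul_of_nonneg_right h3 (by positivity)
  refine ((finset_sum _ (Set.mem_univ _) hterm).congr fun z hz => ?_).mono le_rfl ?_
  · rw [e z hz, add_pow]
    exact Finset.sum_congr rfl fun k _ => by ring
  · rw [← Finset.mul_sum, ← add_pow]
    norm_num

theorem log_one_add (H : Wiener Set.univ h r) (hs : ∀ z : ℂ, ‖z‖ = 1 → ‖h z‖ ≤ 1 / 2) :
    ∃ R, Wiener Set.univ (fun z => Complex.log (1 + h z)) R := by
  obtain ⟨N, hN⟩ := H.exists_pow_bound hs
  have hsum : Summable fun n : ℕ => (2 * ((N * n : ℕ) : ℝ) + 1) * (3 / 4) ^ n := by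
    have h1 := summable_pow_mul_geometric_of_norm_lt_one 1 (r := (3 / 4 : ℝ)) (by norm_num)
    have h2 := summable_geometric_of_lt_one (r := (3 / 4 : ℝ)) (by norm_num) (by norm_num)
    refine ((h1.mul_left (2 * N : ℝ)).add h2).congr fun n => ?_
    push_cast; ring
  refine ⟨_, (tsum (f := fun n z => ((-1) ^ (n + 1) / n : ℂ) * h z ^ n)
    (fun n => ((hN n).const_mul _).mono le_rfl ?_) hsum).congr fun z hz => ?_⟩
  · refine mul_le_of_le_one_left (by positivity) ?_
    rw [norm_div, norm_pow, norm_neg, norm_one, one_pow, Complex.norm_natCast]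
    rcases n.eq_zero_or_pos with rfl | hn
    -- The `n = 0` coefficient is `-1 / 0 = 0`, as the logarithm series requires.
    · simp
    · exact div_le_one_of_le₀ (by exact_mod_cast hn) (by positivity)
  · have := (Complex.hasSum_taylorSeries_log (z := h z) (by linarith [hs z hz])).tsum_eq
    rw [← this]
    exact tsum_congr fun n => by ring

end Wiener

/-- Subtracting `ω θ` from the chosen argument makes `log |f| + i (φ - ω θ)` periodic, hence a
continuous function on the circle. Trigonometric polynomials are uniformly dense there, and `q` is
one of them. -/
theorem exists_trig_log_approx {f : ℂ → ℂ} {ω : ℤ} (hf : Gapped f) (hω : HasWindingNumber f ω) :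
    ∃ (q : ℂ → ℂ) (R : ℝ), Wiener Set.univ q R ∧
      ∀ z : ℂ, ‖z‖ = 1 → ‖z ^ (-ω) * f z * Complex.exp (-q z) - 1‖ ≤ 1 / 2 := by
  obtain ⟨φ, hφ, hpol, hwind⟩ := hω
  have : Fact (0 < 2 * Real.pi) := ⟨Real.two_pi_pos⟩
  have hu : ∀ θ : ℝ, ‖Complex.exp (θ * Complex.I)‖ = 1 := Complex.norm_exp_ofReal_mul_I
  have hfc : Continuous fun θ : ℝ => f (Complex.exp (θ * Complex.I)) :=
    hf.1.comp_continuous (by fun_prop) fun θ => by simp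
  let ψ : ℝ → ℂ := fun θ => (Real.log ‖f (Complex.exp (θ * Complex.I))‖ : ℝ) +
    ((φ θ - ω * θ : ℝ) : ℂ) * Complex.I
  have hψc : Continuous ψ := by
    refine Continuous.add (Complex.continuous_ofReal.comp ?_) ?_
    · exact hfc.norm.log fun θ => norm_ne_zero_iff.mpr (hf.2 _ (hu θ))
    · fun_prop
  have hψexp : ∀ θ : ℝ, Complex.exp (ψ θ) =
      Complex.exp (θ * Complex.I) ^ (-ω) * f (Complex.exp (θ * Complex.I)) := fun θ => by
    have hpos : 0 < ‖f (Complex.exp (θ * Complex.I))‖ := norm_pos_iff.mpr (hf.2 _ (hu θ))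
    simp only [ψ]
    rw [Complex.exp_add, ← Complex.ofReal_exp, Real.exp_log hpos, ← Complex.exp_int_mul]
    conv_rhs => rw [hpol θ]
    rw [mul_left_comm, ← Complex.exp_add]
    congr 2
    push_cast; ring
  have hper : ψ 0 = ψ (0 + 2 * Real.pi) := by
    simp only [ψ, zero_add]
    have h1 : Complex.exp ((2 * Real.pi : ℝ) * Complex.I) = Complex.exp ((0 : ℝ) * Complex.I) := by
      push_cast
      rw [Complex.exp_two_pi_mul_I]; simp
    rw [h1]
    congr 3
    linarith
  let Ψ : C(AddCircle (2 * Real.pi), ℂ) :=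
    ⟨AddCircle.liftIco (2 * Real.pi) 0 ψ, AddCircle.liftIco_continuous hper hψc.continuousOn⟩
  have hmem : Ψ ∈ closure (Submodule.span ℂ (Set.range (@fourier (2 * Real.pi))) :
      Set C(AddCircle (2 * Real.pi), ℂ)) := by
    rw [← Submodule.topologicalClosure_coe, span_fourier_closure_eq_top]
    trivial
  -- The tolerance `1/4` gives the final `1/2` through `|exp w - 1| ≤ 2 |w|` for `|w| ≤ 1`.
  obtain ⟨P, hP, hdist⟩ := Metric.mem_closure_iff.mp hmem (1 / 4) (by norm_num)
  have hPq : ∃ (q : ℂ → ℂ) (R : ℝ), Wiener Set.univ q R ∧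
      ∀ θ : ℝ, P (θ : AddCircle (2 * Real.pi)) = q (Complex.exp (θ * Complex.I)) := by
    refine Submodule.span_induction (p := fun P _ => ∃ (q : ℂ → ℂ) (R : ℝ), Wiener Set.univ q R ∧
      ∀ θ : ℝ, P (θ : AddCircle (2 * Real.pi)) = q (Complex.exp (θ * Complex.I))) ?_ ?_ ?_ ?_ hP
    · rintro _ ⟨n, rfl⟩
      refine ⟨_, _, (Wiener.monomial n).mono (Set.subset_univ _) le_rfl, fun θ => ?_⟩
      rw [fourier_coe_apply, ← Complex.exp_int_mul]
      congr 1
      have : (Real.pi : ℂ) ≠ 0 := by exact_mod_cast Real.pi_ne_zero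
      push_cast
      field_simp
    · exact ⟨_, _, Wiener.const 0 (Set.mem_univ _), fun θ => rfl⟩
    · rintro P₁ P₂ _ _ ⟨q₁, R₁, h₁, e₁⟩ ⟨q₂, R₂, h₂, e₂⟩
      exact ⟨_, _, h₁.add h₂, fun θ => by rw [ContinuousMap.add_apply, e₁, e₂]⟩
    · rintro a P₁ _ ⟨q₁, R₁, h₁, e₁⟩
      exact ⟨_, _, h₁.const_mul a, fun θ => by rw [ContinuousMap.smul_apply, e₁, smul_eq_mul]⟩
  obtain ⟨q, R, hq, hqe⟩ := hPq
  refine ⟨q, R, hq, fun z hz => ?_⟩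
  obtain ⟨θ, hθ, rfl⟩ := exp_mul_I_surj hz
  have h1 : Ψ (θ : AddCircle (2 * Real.pi)) = ψ θ :=
    AddCircle.liftIco_coe_apply (f := ψ) (by rwa [zero_add])
  have h2 : ‖ψ θ - q (Complex.exp (θ * Complex.I))‖ ≤ 1 / 4 := by
    rw [← h1, ← hqe, ← dist_eq_norm]
    exact (ContinuousMap.dist_apply_le_dist _).trans hdist.le
  rw [← hψexp, ← Complex.exp_add, ← sub_eq_add_neg]
  refine (Complex.norm_exp_sub_one_le (h2.trans (by norm_num))).trans ?_
  linarith

/-- `V = q + log(z^{-ω} f e^{-q})`: the second argument is within `1/2` of `1`, so the principal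
logarithm stays in the Wiener algebra. -/
theorem exists_wiener_log {f : ℂ → ℂ} {ω : ℤ} {r : ℝ} (hW : Wiener Set.univ f r) (hf : Gapped f)
    (hω : HasWindingNumber f ω) :
    ∃ (V : ℂ → ℂ) (R : ℝ), Wiener Set.univ V R ∧
      ∀ z : ℂ, ‖z‖ = 1 → Complex.exp (V z) = z ^ (-ω) * f z := by
  have hadd : ∀ a ∈ (Set.univ : Set ℤ), ∀ b ∈ (Set.univ : Set ℤ), a + b ∈ (Set.univ : Set ℤ) :=
    fun _ _ _ _ => Set.mem_univ _
  obtain ⟨q, R, hq, hle⟩ := exists_trig_log_approx hf hω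
  obtain ⟨R', hE⟩ := (hq.const_mul (-1)).exp (Set.mem_univ _) hadd
  have hG := (((((Wiener.monomial (-ω)).mono (Set.subset_univ _) le_rfl).mul_of_add_mem hW
    hadd).mul_of_add_mem hE hadd).add (Wiener.const (-1) (Set.mem_univ _)))
  obtain ⟨R'', hL⟩ := hG.log_one_add fun z hz => by
    simpa [sub_eq_add_neg] using hle z hz
  refine ⟨_, _, hq.add hL, fun z hz => ?_⟩
  have hne : z ^ (-ω) * f z ≠ 0 :=
    mul_ne_zero (zpow_ne_zero _ (ne_zero_of_norm_one hz)) (hf.2 z hz)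
  rw [Complex.exp_add]
  rw [show (1 + (z ^ (-ω) * f z * Complex.exp (-1 * q z) + -1)) =
    z ^ (-ω) * f z * Complex.exp (-1 * q z) by ring]
  rw [Complex.exp_log (mul_ne_zero hne (Complex.exp_ne_zero _)), mul_left_comm, ← Complex.exp_add]
  simp

/-- The nonzero Fourier coefficients of a logarithm of a function with real coefficients are
real. -/
theorem coeff_log_real {V F : ℂ → ℂ} {R : ℝ} (hV : Wiener Set.univ V R)
    (hexp : ∀ z : ℂ, ‖z‖ = 1 → Complex.exp (V z) = F z)
    (hF : ∀ z : ℂ, ‖z‖ = 1 → (starRingEnd ℂ) (F ((starRingEnd ℂ) z)) = F z) {k : ℤ} (hk : k ≠ 0) :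
    (starRingEnd ℂ) (coeff V k) = coeff V k := by
  have hVF := hV.isFourier
  have hD := hVF.conj.add (hVF.const_mul (-1))
  -- Both terms of `D` are logarithms of the same function, so `D` takes values in `2πiℤ`. It is
  -- continuous on the connected circle, hence constant, and only its zeroth coefficient can
  -- survive.
  set D : ℂ → ℂ := fun z => (starRingEnd ℂ) (V ((starRingEnd ℂ) z)) + -1 * V z with hDdef
  have hconn : IsPreconnected (Metric.sphere (0 : ℂ) 1) :=
    isPreconnected_sphere (by rw [Complex.rank_real_complex]; exact Nat.one_lt_ofNat) 0 1
  have hval : ∀ z ∈ Metric.sphere (0 : ℂ) 1, ∃ n : ℤ, D z = n * (2 * Real.pi * Complex.I) := by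
    intro z hz
    have hz' : ‖z‖ = 1 := by simpa using hz
    have : Complex.exp (D z) = 1 := by
      simp only [hDdef]
      rw [Complex.exp_add, Complex.exp_conj, hexp _ (by simpa using hz'), hF z hz', ← hexp z hz',
        ← Complex.exp_add]
      simp
    exact Complex.exp_eq_one_iff.mp this
  have hdisc : IsDiscrete (AddSubgroup.zmultiples (1 : ℝ) : Set ℝ) := by
    rw [SetLike.isDiscrete_iff_discreteTopology]
    infer_instance
  have hval' : ∀ z ∈ Metric.sphere (0 : ℂ) 1,
      D z = ((D z).im / (2 * Real.pi) : ℝ) * (2 * Real.pi * Complex.I) ∧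
        (D z).im / (2 * Real.pi) ∈ (AddSubgroup.zmultiples (1 : ℝ) : Set ℝ) := fun z hz => by
    obtain ⟨n, hn⟩ := hval z hz
    have h1 : (D z).im / (2 * Real.pi) = n := by
      rw [hn]; simp [Real.pi_ne_zero]
    exact ⟨by rw [h1, hn]; simp, n, by simp [h1]⟩
  have hconst : ∀ z : ℂ, ‖z‖ = 1 → D z = D 1 := by
    intro z hz
    have hz' : z ∈ Metric.sphere (0 : ℂ) 1 := by simpa using hz
    have h1' : (1 : ℂ) ∈ Metric.sphere (0 : ℂ) 1 := by simp
    have h2 := hconn.constant_of_mapsTo hdisc (f := fun z => (D z).im / (2 * Real.pi))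
      ((Complex.continuous_im.comp_continuousOn hD.continuousOn).div_const _)
      (fun z hz => (hval' z hz).2) hz' h1'
    rw [(hval' z hz').1, (hval' 1 h1').1]
    simp only [h2]
  have h1 := (Wiener.const (D 1) (M := {0}) rfl)
  have h2 := h1.isFourier.congr hconst
  have h3 := congrFun (hD.unique h2) k
  rw [h1.coeff_eq_zero (by simpa using hk)] at h3
  linear_combination h3

open scoped symmDiff

/-! ### Majorana operators -/

theorem mem_symmDiff_singleton {m n : ℕ} (h : m ≠ n) (S : Finset ℕ) : m ∈ S ∆ {n} ↔ m ∈ S := by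
  simp [Finset.mem_symmDiff, h]

theorem self_mem_symmDiff_singleton (n : ℕ) (S : Finset ℕ) : n ∈ S ∆ {n} ↔ n ∉ S := by
  simp [Finset.mem_symmDiff]

theorem symmDiff_singleton_of_mem {n : ℕ} {S : Finset ℕ} (h : n ∈ S) : S ∆ {n} = S.erase n := by
  ext m
  simp only [Finset.mem_symmDiff, Finset.mem_singleton, Finset.mem_erase]
  by_cases hm : m = n
  · subst hm; simp [h]
  · simp [hm]

theorem symmDiff_singleton_of_notMem {n : ℕ} {S : Finset ℕ} (h : n ∉ S) :
    S ∆ {n} = insert n S := by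
  ext m
  simp only [Finset.mem_symmDiff, Finset.mem_singleton, Finset.mem_insert]
  by_cases hm : m = n
  · subst hm; simp [h]
  · simp [hm]

theorem neg_one_pow_card_symmDiff_singleton (n : ℕ) (S : Finset ℕ) :
    (-1 : ℂ) ^ (S ∆ {n}).card = -(-1) ^ S.card := by
  by_cases h : n ∈ S
  · rw [symmDiff_singleton_of_mem h, ← Finset.card_erase_add_one h, pow_succ]; ring
  · rw [symmDiff_singleton_of_notMem h, Finset.card_insert_of_notMem h, pow_succ]; ring

theorem jwSign_symmDiff_of_lt {m n : ℕ} (h : n < m) (S : Finset ℕ) :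
    jwSign m (S ∆ {n}) = -jwSign m S := by
  have : (S ∆ {n}).filter (· < m) = (S.filter (· < m)) ∆ {n} := by
    ext k
    simp only [Finset.mem_filter, Finset.mem_symmDiff, Finset.mem_singleton]
    by_cases hk : k = n
    · subst hk; simp [h]
    · simp [hk]
  rw [jwSign, this, neg_one_pow_card_symmDiff_singleton, jwSign]

theorem jwSign_symmDiff_of_le {m n : ℕ} (h : m ≤ n) (S : Finset ℕ) :
    jwSign m (S ∆ {n}) = jwSign m S := by
  have : (S ∆ {n}).filter (· < m) = S.filter (· < m) := by
    ext k
    simp only [Finset.mem_filter, Finset.mem_symmDiff, Finset.mem_singleton]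
    by_cases hk : k = n
    · subst hk; simp [h]
    · simp [hk]
  rw [jwSign, this, jwSign]

theorem jwSign_mul_self (n : ℕ) (S : Finset ℕ) : jwSign n S * jwSign n S = 1 := by
  rw [jwSign, ← mul_pow]; simp

/-- Written with `S ∆ {n}`, annihilation and creation both flip site `n`. Each Majorana operator
then becomes a signed flip with no case distinction, and flips commute. -/
theorem annih_apply (n : ℕ) (ψ : Fock) (S : Finset ℕ) :
    annih n ψ S = if n ∈ S then 0 else jwSign n S * ψ (S ∆ {n}) := by
  change annihFun n ψ S = _
  unfold annihFun
  split_ifs with h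
  · rfl
  · rw [symmDiff_singleton_of_notMem h]

theorem annih_single (n : ℕ) (S : Finset ℕ) :
    annih n (lp.single 2 S (1 : ℂ)) =
      if n ∈ S then lp.single 2 (S ∆ {n}) (jwSign n S) else 0 := by
  ext T
  rw [annih_apply]
  have hiff : T ∆ {n} = S ↔ T = S ∆ {n} := by
    constructor
    · rintro rfl; rw [symmDiff_symmDiff_cancel_right]
    · rintro rfl; rw [symmDiff_symmDiff_cancel_right]
  by_cases hS : n ∈ S
  · rw [if_pos hS, lp.single_apply, lp.single_apply]
    by_cases hT : T = S ∆ {n}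
    · subst hT
      have : n ∉ S ∆ {n} := by rw [self_mem_symmDiff_singleton]; simpa using hS
      simp [this, symmDiff_symmDiff_cancel_right, jwSign_symmDiff_of_le le_rfl]
    · simp [hiff, hT]
  · rw [if_neg hS, lp.single_apply]
    by_cases hT : n ∈ T
    · simp [hT]
    · have : T ∆ {n} ≠ S := by
        rintro rfl
        exact hS ((self_mem_symmDiff_singleton n T).mpr hT)
      simp [this]

theorem adjoint_annih_apply (n : ℕ) (ψ : Fock) (S : Finset ℕ) :
    ContinuousLinearMap.adjoint (annih n) ψ S =
      if n ∈ S then jwSign n S * ψ (S ∆ {n}) else 0 := by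
  have h1 : inner ℂ (lp.single 2 S (1 : ℂ)) (ContinuousLinearMap.adjoint (annih n) ψ) =
      ContinuousLinearMap.adjoint (annih n) ψ S := by
    rw [lp.inner_single_left]; simp
  rw [← h1, ContinuousLinearMap.adjoint_inner_right, annih_single]
  split_ifs with h
  · rw [lp.inner_single_left, RCLike.inner_apply, mul_comm]
    congr 1
    simp [jwSign]
  · simp

theorem majA_apply (n : ℕ) (ψ : Fock) (S : Finset ℕ) :
    majA n ψ S = jwSign n S * ψ (S ∆ {n}) := by
  change annih n ψ S + ContinuousLinearMap.adjoint (annih n) ψ S = _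
  rw [annih_apply, adjoint_annih_apply]
  split_ifs <;> simp

/-- The sign `1` for occupied and `-1` for empty sites. -/
def occSign (n : ℕ) (S : Finset ℕ) : ℂ := if n ∈ S then 1 else -1

theorem occSign_symmDiff_of_ne {m n : ℕ} (h : m ≠ n) (S : Finset ℕ) :
    occSign m (S ∆ {n}) = occSign m S := by
  simp only [occSign, mem_symmDiff_singleton h]

theorem occSign_symmDiff_self (n : ℕ) (S : Finset ℕ) : occSign n (S ∆ {n}) = -occSign n S := by
  simp only [occSign, self_mem_symmDiff_singleton]
  split_ifs <;> simp_all

theorem occSign_mul_self (n : ℕ) (S : Finset ℕ) : occSign n S * occSign n S = 1 := by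
  unfold occSign; split_ifs <;> simp

theorem majB_apply (n : ℕ) (ψ : Fock) (S : Finset ℕ) :
    majB n ψ S = Complex.I * (occSign n S * jwSign n S * ψ (S ∆ {n})) := by
  change Complex.I * (ContinuousLinearMap.adjoint (annih n) ψ S - annih n ψ S) = _
  rw [annih_apply, adjoint_annih_apply]
  unfold occSign
  split_ifs <;> simp

theorem op_ext {A B : Op} (h : ∀ (ψ : Fock) (S : Finset ℕ), A ψ S = B ψ S) : A = B :=
  ContinuousLinearMap.ext fun ψ => lp.ext (funext fun S => h ψ S)

/-- Flipping the smaller site changes the sign attached to the larger one but not conversely. All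
anticommutation relations at distinct sites come from this. -/
theorem jwSign_anticomm {m n : ℕ} (h : m ≠ n) (S : Finset ℕ) :
    jwSign m S * jwSign n (S ∆ {m}) = -(jwSign n S * jwSign m (S ∆ {n})) := by
  rcases lt_or_gt_of_ne h with h | h
  · rw [jwSign_symmDiff_of_lt h, jwSign_symmDiff_of_le h.le]; ring
  · rw [jwSign_symmDiff_of_lt h, jwSign_symmDiff_of_le h.le]; ring

theorem majA_anticomm (m n : ℕ) :
    majA m * majA n + majA n * majA m = if m = n then 1 + 1 else 0 := by
  refine op_ext fun ψ S => ?_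
  change majA m (majA n ψ) S + majA n (majA m ψ) S = _
  simp only [majA_apply]
  split_ifs with h
  · subst h
    rw [symmDiff_symmDiff_cancel_right, jwSign_symmDiff_of_le le_rfl, ← mul_assoc,
      jwSign_mul_self, one_mul]
    rfl
  · rw [symmDiff_right_comm S {n} {m}]
    change _ = (0 : ℂ)
    linear_combination ψ (S ∆ {m} ∆ {n}) * jwSign_anticomm h S

theorem majB_anticomm (m n : ℕ) :
    majB m * majB n + majB n * majB m = if m = n then 1 + 1 else 0 := by
  refine op_ext fun ψ S => ?_
  change majB m (majB n ψ) S + majB n (majB m ψ) S = _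
  simp only [majB_apply]
  split_ifs with h
  · subst h
    rw [symmDiff_symmDiff_cancel_right, jwSign_symmDiff_of_le le_rfl, occSign_symmDiff_self]
    have h1 := jwSign_mul_self m S
    have h2 := occSign_mul_self m S
    have h3 := Complex.I_mul_I
    change _ = ψ S + ψ S
    linear_combination (-2 * ψ S * occSign m S ^ 2 * jwSign m S ^ 2) * h3 +
      (2 * ψ S * occSign m S ^ 2) * h1 + (2 * ψ S) * h2
  · rw [symmDiff_right_comm S {n} {m}, occSign_symmDiff_of_ne h,
      occSign_symmDiff_of_ne (Ne.symm h)]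
    change _ = (0 : ℂ)
    linear_combination (Complex.I ^ 2 * occSign m S * occSign n S * ψ (S ∆ {m} ∆ {n})) *
      jwSign_anticomm h S

theorem majA_majB_anticomm (m n : ℕ) : majA m * majB n + majB n * majA m = 0 := by
  refine op_ext fun ψ S => ?_
  change majA m (majB n ψ) S + majB n (majA m ψ) S = (0 : ℂ)
  simp only [majA_apply, majB_apply]
  by_cases h : m = n
  · subst h
    rw [symmDiff_symmDiff_cancel_right, jwSign_symmDiff_of_le le_rfl, occSign_symmDiff_self]
    ring
  · rw [symmDiff_right_comm S {n} {m}, occSign_symmDiff_of_ne (Ne.symm h)]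
    linear_combination (Complex.I * occSign n S * ψ (S ∆ {m} ∆ {n})) * jwSign_anticomm h S

theorem norm_annih_le (n : ℕ) : ‖annih n‖ ≤ 1 :=
  LinearMap.mkContinuous_norm_le _ zero_le_one _

theorem norm_majA_le (n : ℕ) : ‖majA n‖ ≤ 2 := by
  refine (norm_add_le _ _).trans ?_
  rw [LinearIsometryEquiv.norm_map]
  linarith [norm_annih_le n]

theorem norm_majB_le (n : ℕ) : ‖majB n‖ ≤ 2 := by
  rw [majB, norm_smul, Complex.norm_I, one_mul]
  refine (norm_sub_le _ _).trans ?_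
  rw [LinearIsometryEquiv.norm_map]
  linarith [norm_annih_le n]

/-! ### Edge modes from Toeplitz equations -/

theorem hasSum_anticomm {χ : ℕ → Op} {g : ℕ → ℝ} {Γ X : Op} {b : ℕ → Op}
    (H : HasSum (fun n => (g n : ℂ) • χ n) Γ) (hX : ∀ n, χ n * X + X * χ n = b n) :
    HasSum (fun n => (g n : ℂ) • b n) (Γ * X + X * Γ) := by
  convert! (H.mul_right X).add (H.mul_left X) using 2 with n
  rw [← hX n, smul_add, smul_mul_assoc, mul_smul_comm]

/-- The anticommutator with `χ n` reads off the wavefunction. It serves both the commutator with the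
chain and linear independence. -/
theorem anticomm_eq {χ : ℕ → Op} (hχ : ∀ m n, χ m * χ n + χ n * χ m = if m = n then 1 + 1 else 0)
    {g : ℕ → ℝ} {Γ : Op} (H : HasSum (fun n => (g n : ℂ) • χ n) Γ) (n : ℕ) :
    Γ * χ n + χ n * Γ = (2 * g n : ℂ) • (1 : Op) := by
  refine (hasSum_anticomm H fun m => hχ m n).unique ?_
  convert! hasSum_ite_eq n ((2 * g n : ℂ) • (1 : Op)) using 2 with m
  split_ifs with h
  · rw [h, mul_comm, mul_smul, two_smul]
  · simp

theorem anticomm_eq_zero {χ : ℕ → Op} {X : Op} (hX : ∀ n, χ n * X + X * χ n = 0)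
    {g : ℕ → ℝ} {Γ : Op} (H : HasSum (fun n => (g n : ℂ) • χ n) Γ) : Γ * X + X * Γ = 0 := by
  refine (hasSum_anticomm H hX).unique ?_
  simp [hasSum_zero]

/-- If `∑ₘ u_{n-m} gₘ = 0` for all `n ≥ 0`, the truncated sums tend to zero. -/
theorem tendsto_truncated_toeplitz {X : ℕ → Op} (hX : ∀ n, ‖X n‖ ≤ 2) {u : ℤ → ℝ} {g : ℕ → ℝ}
    (hu : Summable fun n => |u n|) (hg : Summable fun n => |g n|)
    (hz : ∀ n : ℕ, ∑' m : ℕ, u (n - m) * g m = 0) :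
    Tendsto (fun N => ∑ n ∈ Finset.range N, ∑ m ∈ Finset.range N,
      ((u ((n : ℤ) - m) * g m : ℝ) : ℂ) • X n) atTop (𝓝 0) := by
  have hub : ∀ k, |u k| ≤ ∑' k, |u k| := fun k => hu.le_tsum k fun _ _ => abs_nonneg _
  have hsum : ∀ n : ℤ, Summable fun m : ℕ => |u (n - m) * g m| := fun n => by
    refine .of_nonneg_of_le (fun _ => abs_nonneg _) (fun m => ?_) (hg.mul_left (∑' k, |u k|))
    rw [abs_mul]
    exact mul_le_mul_of_nonneg_right (hub _) (abs_nonneg _)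
  have hrow : ∀ (N : ℕ) (k : ℤ), ∑ n ∈ Finset.range N, |u (n - k)| ≤ ∑' k, |u k| := fun N k => by
    have hinj : Set.InjOn (fun n : ℕ => (n : ℤ) - k) (Finset.range N) := fun a _ b _ h => by
      simpa using h
    rw [← Finset.sum_image (f := fun j => |u j|) hinj]
    exact hu.sum_le_tsum _ fun _ _ => abs_nonneg _
  have htail : Tendsto (fun N => 2 * ((∑' k, |u k|) * ∑' m, |g (m + N)|)) atTop (𝓝 0) := by
    have := ((tendsto_sum_nat_add fun m => |g m|).const_mul (∑' k, |u k|)).const_mul 2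
    simpa using this
  refine squeeze_zero_norm (fun N => ?_) htail
  have h1 : ∀ n ∈ Finset.range N,
      ‖∑ m ∈ Finset.range N, ((u ((n : ℤ) - m) * g m : ℝ) : ℂ) • X n‖ ≤
        2 * ∑' m : ℕ, |u (n - (m + N : ℕ)) * g (m + N)| := fun n _ => by
    have hs : Summable fun m : ℕ => u ((n : ℤ) - m) * g m := Summable.of_abs (hsum n)
    have h2 := hs.sum_add_tsum_nat_add N
    -- The equation trades the sum over `m < N` for minus its tail. Since each column of `u` has
    -- absolute sum at most `‖u‖₁`, the total is at most `2 ‖u‖₁ ∑_{m ≥ N} |g m|`.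
    rw [hz n] at h2
    rw [← Finset.sum_smul, norm_smul, mul_comm, ← Complex.ofReal_sum, Complex.norm_real,
      Real.norm_eq_abs, eq_neg_of_add_eq_zero_left h2, abs_neg]
    refine mul_le_mul (hX n) ?_ (abs_nonneg _) zero_le_two
    exact norm_tsum_le_tsum_norm (f := fun m : ℕ => u ((n : ℤ) - (m + N : ℕ)) * g (m + N))
      ((summable_nat_add_iff N).mpr (hsum n))
  refine (norm_sum_le_of_le _ h1).trans ?_
  rw [← Finset.mul_sum]
  refine mul_le_mul_of_nonneg_left ?_ zero_le_two
  have hshift : ∀ n : ℕ, Summable fun m : ℕ => |u (n - (m + N : ℕ)) * g (m + N)| := fun n =>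
    (summable_nat_add_iff N).mpr (hsum n)
  rw [← Summable.tsum_finsetSum fun n _ => hshift n, ← tsum_mul_left]
  refine Summable.tsum_le_tsum (fun m => ?_) (summable_sum fun n _ => hshift n)
    (((summable_nat_add_iff N).mpr hg).mul_left _)
  simp only [abs_mul, ← Finset.sum_mul]
  exact mul_le_mul_of_nonneg_right (hrow N _) (abs_nonneg _)

theorem one_op_ne_zero : (1 : Op) ≠ 0 := fun h => by
  have h1 := congrArg (fun A : Op => A (lp.single (E := fun _ => ℂ) 2 (∅ : Finset ℕ) 1) ∅) h
  change lp.single (E := fun _ : Finset ℕ => ℂ) 2 ∅ 1 ∅ = (0 : ℂ) at h1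
  simp at h1

/-- Anticommuting a vanishing combination with `χ n` gives `∑ i, c i * g i n = 0`. Since `g i`
starts at site `i` with a nonzero entry, the `c i` vanish one after the other. Absolute summability
of `g` gives norm convergence of the modes and square summability. -/
theorem hasEdgeModes_of_triangular {χ : ℕ → Op} {t : ℤ → ℝ} {K : ℕ} {g : Fin K → ℕ → ℝ}
    (hχ : ∀ m n, χ m * χ n + χ n * χ m = if m = n then 1 + 1 else 0) (hn : ∀ n, ‖χ n‖ ≤ 2)
    (hg : ∀ i, Summable fun n => |g i n|) (hlt : ∀ (i : Fin K) (n : ℕ), n < (i : ℕ) → g i n = 0)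
    (hd : ∀ i : Fin K, g i i ≠ 0)
    (hcomm : ∀ i Γ, HasSum (fun n => (g i n : ℂ) • χ n) Γ →
      Tendsto (fun N => Γ * ham t N - ham t N * Γ) atTop (𝓝 0)) :
    HasEdgeModes χ t g := by
  have hsum : ∀ i, Summable fun n => (g i n : ℂ) • χ n := fun i => by
    refine .of_norm_bounded ((hg i).mul_right 2) fun n => ?_
    rw [norm_smul, Complex.norm_real, Real.norm_eq_abs]
    exact mul_le_mul_of_nonneg_left (hn n) (abs_nonneg _)
  refine ⟨fun i => ∑' n, (g i n : ℂ) • χ n, ?_, fun i => ⟨?_, (hsum i).hasSum,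
    hcomm i _ (hsum i).hasSum⟩⟩
  · rw [Fintype.linearIndependent_iff]
    intro c hc
    have key : ∀ n : ℕ, ∑ i, c i * g i n = 0 := fun n => by
      have h1 : ∑ i, c i • ((∑' n, (g i n : ℂ) • χ n) * χ n + χ n * ∑' n, (g i n : ℂ) • χ n) =
          0 := by
        refine Eq.trans ?_ (show (0 : Op) * χ n + χ n * 0 = 0 by simp)
        rw [← hc]
        simp only [smul_add, Finset.sum_add_distrib, smul_mul_assoc, mul_smul_comm, Finset.sum_mul,
          Finset.mul_sum]
      simp only [anticomm_eq hχ (hsum _).hasSum, smul_smul, ← Finset.sum_smul] at h1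
      have h2 := (smul_eq_zero.mp h1).resolve_right one_op_ne_zero
      have h3 : 2 * ∑ i, c i * g i n = 0 := by
        rw [Finset.mul_sum, ← h2]
        exact Finset.sum_congr rfl fun i _ => by ring
      simpa using h3
    intro i
    induction i using WellFoundedLT.induction with
    | ind i ih =>
      have h1 := key i
      rw [Finset.sum_eq_single i] at h1
      · exact (mul_eq_zero.mp h1).resolve_right (Complex.ofReal_ne_zero.mpr (hd i))
      · intro j _ hj
        rcases lt_or_gt_of_ne hj with hji | hji
        · rw [ih j hji, zero_mul]
        · rw [hlt j i hji, Complex.ofReal_zero, mul_zero]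
      · simp
  · refine .of_nonneg_of_le (fun _ => sq_nonneg _) (fun n => ?_) ((hg i).mul_left (∑' n, |g i n|))
    rw [← sq_abs, sq]
    exact mul_le_mul_of_nonneg_right ((hg i).le_tsum n fun _ _ => abs_nonneg _) (abs_nonneg _)

/-- `Γ` anticommutes with every `γ̃`, so `[Γ, γ̃_n γ_m] = -2 g_m γ̃_n` and the commutator is `-i ∑
t_{m-n} g_m γ̃_n`, a Toeplitz sum with reflected couplings. -/
theorem hasEdgeModes_majA {t : ℤ → ℝ} {K : ℕ} {g : Fin K → ℕ → ℝ}
    (ht : Summable fun n => |t n|)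
    (hg : ∀ i, Summable fun n => |g i n|) (hlt : ∀ (i : Fin K) (n : ℕ), n < (i : ℕ) → g i n = 0)
    (hd : ∀ i : Fin K, g i i ≠ 0) (hz : ∀ i (n : ℕ), ∑' m : ℕ, t (-(n - m)) * g i m = 0) :
    HasEdgeModes majA t g := by
  refine hasEdgeModes_of_triangular majA_anticomm norm_majA_le hg hlt hd fun i Γ H => ?_
  have h0 := (tendsto_truncated_toeplitz norm_majB_le (u := fun k => t (-k))
    ((Equiv.neg ℤ).summable_iff.mpr ht) (hg i) (hz i)).const_smul (-Complex.I)
  rw [smul_zero] at h0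
  refine h0.congr fun N => ?_
  have h1 : ∀ m n, Γ * (majB n * majA m) - majB n * majA m * Γ = (-2 * g i m : ℂ) • majB n := by
    intro m n
    have e1 := anticomm_eq majA_anticomm H m
    have e2 := anticomm_eq_zero (fun k => majA_majB_anticomm k n) H
    have e3 : Γ * (majB n * majA m) - majB n * majA m * Γ =
        (Γ * majB n + majB n * Γ) * majA m - majB n * (Γ * majA m + majA m * Γ) := by
      noncomm_ring
    rw [e3, e1, e2, zero_mul, mul_smul_comm, mul_one, zero_sub, ← neg_smul, neg_mul]
  simp only [ham, mul_smul_comm, smul_mul_assoc, Finset.mul_sum, Finset.sum_mul]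
  rw [← smul_sub, ← Finset.sum_sub_distrib, Finset.sum_comm]
  simp only [← Finset.sum_sub_distrib, ← smul_sub, h1, Finset.smul_sum, smul_smul]
  refine Finset.sum_congr rfl fun m _ => Finset.sum_congr rfl fun n _ => ?_
  congr 1
  rw [neg_sub]
  push_cast; ring

/-- Here `[Γ, γ̃_n γ_m] = 2 g_n γ_m`: the wavefunction sits on the other index, so the couplings
enter unreflected. -/
theorem hasEdgeModes_majB {t : ℤ → ℝ} {K : ℕ} {g : Fin K → ℕ → ℝ}
    (ht : Summable fun n => |t n|)
    (hg : ∀ i, Summable fun n => |g i n|) (hlt : ∀ (i : Fin K) (n : ℕ), n < (i : ℕ) → g i n = 0)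
    (hd : ∀ i : Fin K, g i i ≠ 0) (hz : ∀ i (n : ℕ), ∑' m : ℕ, t (n - m) * g i m = 0) :
    HasEdgeModes majB t g := by
  refine hasEdgeModes_of_triangular majB_anticomm norm_majB_le hg hlt hd fun i Γ H => ?_
  have h0 := (tendsto_truncated_toeplitz norm_majA_le ht (hg i) (hz i)).const_smul Complex.I
  rw [smul_zero] at h0
  refine h0.congr fun N => ?_
  have h1 : ∀ m n, Γ * (majB n * majA m) - majB n * majA m * Γ = (2 * g i n : ℂ) • majA m := by
    intro m n
    have e1 := anticomm_eq majB_anticomm H n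
    have e2 := anticomm_eq_zero (X := majA m)
      (fun k => (add_comm _ _).trans (majA_majB_anticomm m k)) H
    have e3 : Γ * (majB n * majA m) - majB n * majA m * Γ =
        (Γ * majB n + majB n * Γ) * majA m - majB n * (Γ * majA m + majA m * Γ) := by
      noncomm_ring
    rw [e3, e1, e2, mul_zero, smul_mul_assoc, one_mul, sub_zero]
  simp only [ham, mul_smul_comm, smul_mul_assoc, Finset.mul_sum, Finset.sum_mul]
  rw [← smul_sub, ← Finset.sum_sub_distrib]
  simp only [← Finset.sum_sub_distrib, ← smul_sub, h1, Finset.smul_sum, smul_smul]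
  refine Finset.sum_congr rfl fun m _ => Finset.sum_congr rfl fun n _ => ?_
  congr 1
  push_cast; ring

/-! ### Edge modes from factorisations -/

section Factorisation

variable {t : ℤ → ℝ} {F h : ℂ → ℂ} {L : ℤ} {r R : ℝ} {K : ℕ} {g : Fin K → ℕ → ℝ}

/-- The sum is the `n`-th coefficient of `z^i h F`, and that product has exponents at most `L + i <
0 ≤ n`. The convolution over `ℤ` reduces to one over `ℕ` because `h` has no negative exponents. -/
theorem tsum_toeplitz_eq_zero (ht : IsFourier (fun n => (t n : ℂ)) F) (hh : Wiener (Set.Ici 0) h r)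
    (hp : Wiener (Set.Iic L) (fun z => F z * h z) R) (hK : ∀ m : ℕ, m < K → L + m < 0)
    (hg : AreShiftedCoeffs h g) (i : Fin K) (n : ℕ) : ∑' m : ℕ, t (n - m) * g i m = 0 := by
  have h1 := (hh.isFourier.zpow_mul (i : ℕ)).mul ht
  have h2 := (hp.isFourier.zpow_mul (i : ℕ)).congr
    (h' := fun z => z ^ ((i : ℕ) : ℤ) * h z * F z) fun z _ => by ring
  have h3 := congrFun (h1.1.unique h2) n
  have hi := hK i i.2
  rw [hp.coeff_eq_zero (by simp; omega)] at h3
  have hsupp : (Function.support fun j : ℤ => coeff h (j - (i : ℕ)) * (t (n - j) : ℂ)) ⊆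
      Set.range ((↑) : ℕ → ℤ) := fun j hj => by
    by_contra hneg
    refine hj ?_
    have : j < 0 := by
      by_contra h0
      exact hneg ⟨j.toNat, by omega⟩
    simp only
    rw [hh.coeff_eq_zero (by simp; omega), zero_mul]
  rw [← Function.Injective.tsum_eq Nat.cast_injective hsupp] at h3
  have h4 : ((∑' m : ℕ, t (n - m) * g i m : ℝ) : ℂ) = 0 := by
    rw [← h3, Complex.ofReal_tsum]
    refine tsum_congr fun m => ?_
    rw [Complex.ofReal_mul, hg i m, mul_comm]
  exact_mod_cast h4

theorem AreShiftedCoeffs.summable (hh : Wiener (Set.Ici 0) h r) (hg : AreShiftedCoeffs h g)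
    (i : Fin K) : Summable fun n => |g i n| := by
  have h1 := (hh.isFourier.zpow_mul (i : ℕ)).summable.comp_injective Nat.cast_injective
  refine h1.congr fun n => ?_
  simp only [Function.comp]
  rw [← hg i n, Complex.norm_real, Real.norm_eq_abs]

theorem AreShiftedCoeffs.eq_zero (hh : Wiener (Set.Ici 0) h r) (hg : AreShiftedCoeffs h g)
    (i : Fin K) (n : ℕ) (hn : n < (i : ℕ)) : g i n = 0 := by
  have h1 := hg i n
  rw [hh.coeff_eq_zero (by simp; omega)] at h1
  exact_mod_cast h1

theorem AreShiftedCoeffs.diag_ne_zero (h0 : coeff h 0 ≠ 0) (hg : AreShiftedCoeffs h g)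
    (i : Fin K) : g i i ≠ 0 := fun h => by
  have h1 := hg i i
  rw [h, sub_self] at h1
  exact h0 (by simpa using h1.symm)

theorem IsFourier.summable_abs (ht : IsFourier (fun n => (t n : ℂ)) F) :
    Summable fun n => |t n| := by
  simpa using ht.summable

theorem hasEdgeModes_majB_of_wiener (ht : IsFourier (fun n => (t n : ℂ)) F)
    (hh : Wiener (Set.Ici 0) h r) (h0 : coeff h 0 ≠ 0)
    (hp : Wiener (Set.Iic L) (fun z => F z * h z) R) (hK : ∀ m : ℕ, m < K → L + m < 0)
    (hg : AreShiftedCoeffs h g) : HasEdgeModes majB t g :=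
  hasEdgeModes_majB ht.summable_abs (hg.summable hh) (hg.eq_zero hh) (hg.diag_ne_zero h0)
    (tsum_toeplitz_eq_zero ht hh hp hK hg)

theorem hasEdgeModes_majA_of_wiener (ht : IsFourier (fun n => (t n : ℂ)) F)
    (hh : Wiener (Set.Ici 0) h r) (h0 : coeff h 0 ≠ 0)
    (hp : Wiener (Set.Iic L) (fun z => F (1 / z) * h z) R) (hK : ∀ m : ℕ, m < K → L + m < 0)
    (hg : AreShiftedCoeffs h g) : HasEdgeModes majA t g :=
  hasEdgeModes_majA ht.summable_abs (hg.summable hh) (hg.eq_zero hh) (hg.diag_ne_zero h0)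
    (tsum_toeplitz_eq_zero (t := fun n => t (-n)) ht.inv_arg hh hp hK hg)

theorem exists_areShiftedCoeffs (hh : Wiener (Set.Ici 0) h r)
    (hreal : ∀ z : ℂ, ‖z‖ = 1 → (starRingEnd ℂ) (h ((starRingEnd ℂ) z)) = h z) (K : ℕ) :
    ∃ g : Fin K → ℕ → ℝ, AreShiftedCoeffs h g := by
  have h1 := congrFun (hh.isFourier.conj.unique (hh.isFourier.congr hreal))
  exact ⟨fun m n => (coeff h (n - (m : ℕ))).re, fun m n => Complex.conj_eq_iff_re.mp (h1 _)⟩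

end Factorisation

/-! ### Decaying couplings -/

theorem summable_one_add_abs_rpow {α : ℝ} (hα : 1 < α) :
    Summable fun n : ℤ => (1 + |(n : ℝ)|) ^ (-α) := by
  have h : Summable fun n : ℕ => (1 + (n : ℝ)) ^ (-α) := by
    have h1 := (summable_nat_add_iff 1).mpr (Real.summable_nat_rpow.mpr (neg_lt_neg hα))
    refine h1.congr fun n => ?_
    push_cast
    rw [add_comm]
  exact .of_nat_of_neg (by simpa using h) (by simpa using h)

theorem IsDecaying.summable {α : ℝ} {t : ℤ → ℝ} (ht : IsDecaying α t) (hα : 1 < α) :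
    Summable fun n => |t n| := by
  obtain ⟨C, hC⟩ := ht
  exact .of_nonneg_of_le (fun _ => abs_nonneg _) hC ((summable_one_add_abs_rpow hα).mul_left C)

theorem isFourier_symbol {t : ℤ → ℝ} (ht : Summable fun n => |t n|) :
    IsFourier (fun n => (t n : ℂ)) (symbol t) :=
  ⟨by simpa using ht, fun _ _ => rfl⟩

theorem symbol_eq_of_isFourier {t : ℤ → ℝ} {h : ℂ → ℂ} (H : IsFourier (fun n => (t n : ℂ)) h)
    {z : ℂ} (hz : ‖z‖ = 1) : symbol t z = h z :=
  (H.eq_tsum z hz).symm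

/-- With `y = (x+1)/x`, the bounds `exp u ≥ 1 + u` and `log y ≥ 1 - 1/y` give `y ^ p ≥ 1 + p/(x+1)`;
multiply by `(x+1) ^ (-p)`. Summed over integer steps it bounds power tails. -/
theorem rpow_add_one_le_telescope {p x : ℝ} (hp : 0 < p) (hx : 0 < x) :
    (x + 1) ^ (-(p + 1)) ≤ p⁻¹ * (x ^ (-p) - (x + 1) ^ (-p)) := by
  have hx1 : 0 < x + 1 := by linarith
  have hy : 0 < (x + 1) / x := by positivity
  have h1 : 1 + p * (1 - ((x + 1) / x)⁻¹) ≤ ((x + 1) / x) ^ p := by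
    rw [Real.rpow_def_of_pos hy]
    have h2 := Real.add_one_le_exp (Real.log ((x + 1) / x) * p)
    have h3 := Real.one_sub_inv_le_log_of_pos hy
    nlinarith
  have h4 : 1 - ((x + 1) / x)⁻¹ = (x + 1)⁻¹ := by field_simp; ring
  rw [h4, Real.div_rpow hx1.le hx.le] at h1
  have hA : 0 < (x + 1) ^ (-p) := Real.rpow_pos_of_pos hx1 _
  have h5 : (x + 1) ^ (-p) * ((x + 1) ^ p / x ^ p) = x ^ (-p) := by
    rw [Real.rpow_neg hx1.le, Real.rpow_neg hx.le]
    have := (Real.rpow_pos_of_pos hx1 p).ne'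
    field_simp
  have h6 : (x + 1) ^ (-(p + 1)) = (x + 1) ^ (-p) * (x + 1)⁻¹ := by
    rw [neg_add, Real.rpow_add hx1, Real.rpow_neg_one]
  have h7 := mul_le_mul_of_nonneg_left h1 hA.le
  rw [h5] at h7
  rw [h6, ← div_eq_inv_mul, le_div_iff₀ hp]
  linarith

theorem sum_rpow_tail_le {p x : ℝ} (hp : 0 < p) (hx : 0 < x) (M : ℕ) :
    ∑ k ∈ Finset.range M, (x + k + 1) ^ (-(p + 1)) ≤ p⁻¹ * x ^ (-p) := by
  have h1 : ∀ k ∈ Finset.range M, (x + k + 1) ^ (-(p + 1)) ≤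
      p⁻¹ * (x + k) ^ (-p) - p⁻¹ * (x + (k + 1 : ℕ)) ^ (-p) := fun k _ => by
    have := rpow_add_one_le_telescope hp (show 0 < x + k by positivity)
    push_cast
    rw [← mul_sub, ← add_assoc]
    exact this
  refine (Finset.sum_le_sum h1).trans ?_
  rw [Finset.sum_range_sub' (fun k : ℕ => p⁻¹ * (x + k) ^ (-p))]
  have : 0 ≤ p⁻¹ * (x + M) ^ (-p) := by positivity
  simpa using this

theorem abs_tsum_tail_le {p x C : ℝ} (hp : 0 < p) (hx : 0 < x) {f : ℕ → ℝ}
    (hf : ∀ k : ℕ, |f k| ≤ C * (x + k + 1) ^ (-(p + 1))) :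
    |∑' k, f k| ≤ C * (p⁻¹ * x ^ (-p)) := by
  have hpos : ∀ k : ℕ, 0 < (x + k + 1) ^ (-(p + 1)) := fun k => by positivity
  have hs : Summable fun k : ℕ => (x + k + 1) ^ (-(p + 1)) :=
    summable_of_sum_range_le (fun k => (hpos k).le) (sum_rpow_tail_le hp hx)
  have hC : 0 ≤ C := by
    have := (abs_nonneg _).trans (hf 0)
    exact nonneg_of_mul_nonneg_left this (hpos 0)
  refine (tsum_of_norm_bounded (f := f) (hs.mul_left C).hasSum hf).trans ?_
  rw [tsum_mul_left]
  exact mul_le_mul_of_nonneg_left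
    (Real.tsum_le_of_sum_range_le (fun k => (hpos k).le) (sum_rpow_tail_le hp hx)) hC

theorem rpow_neg_le_two_rpow_mul {p m : ℝ} (hp : 0 < p) (hm : 1 ≤ m) :
    m ^ (-p) ≤ 2 ^ p * (1 + m) ^ (-p) := by
  have h1 : (2 * m) ^ (-p) ≤ (1 + m) ^ (-p) :=
    Real.rpow_le_rpow_of_nonpos (by linarith) (by linarith) (by linarith)
  rw [Real.mul_rpow zero_le_two (by linarith)] at h1
  have h2 := mul_le_mul_of_nonneg_left h1 (Real.rpow_nonneg zero_le_two p)
  rwa [← mul_assoc, ← Real.rpow_add zero_lt_two, add_neg_cancel, Real.rpow_zero, one_mul] at h2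

/-- A family with vanishing total sum is the difference of its tail sums. -/
theorem IsDecaying.exists_antidifference {α : ℝ} {t : ℤ → ℝ} (ht : IsDecaying α t) (hα : 1 < α)
    (h0 : ∑' n, t n = 0) :
    ∃ s : ℤ → ℝ, IsDecaying (α - 1) s ∧ ∀ n, t n = s (n - 1) - s n := by
  have hsum : Summable t := (ht.summable hα).of_abs
  obtain ⟨C, hC⟩ := ht
  have hp : 0 < α - 1 := by linarith
  have hα' : α = α - 1 + 1 := by ring
  have hr : ∀ n : ℤ, Summable fun k : ℕ => t (n + 1 + k) := fun n =>
    hsum.comp_injective fun a b h => by simpa using h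
  have hl : ∀ n : ℤ, Summable fun k : ℕ => t (n - k) := fun n =>
    hsum.comp_injective fun a b h => by simpa using h
  -- The right tail is visibly small only for `n ≥ 0`. The zero total sum turns it into a left tail,
  -- which is small for `n < 0`.
  have hsplit : ∀ n : ℤ, ∑' k : ℕ, t (n + 1 + k) = -∑' k : ℕ, t (n - k) := fun n => by
    have h1 : HasSum (fun j : ℤ => t (j + (n + 1)))
        (∑' k : ℕ, t (n + 1 + k) + ∑' k : ℕ, t (n - k)) := by
      refine HasSum.of_nat_of_neg_add_one ?_ ?_
      · simpa only [add_comm] using (hr n).hasSum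
      · convert! (hl n).hasSum using 3 with k
        ring
    have h2 : HasSum (fun j : ℤ => t (j + (n + 1))) 0 := by
      rw [← h0]
      exact (Equiv.addRight (n + 1)).hasSum_iff.mpr hsum.hasSum
    linarith [h1.unique h2]
  -- The factor `2 ^ (α - 1)` is needed only for `n < 0`, where the tail bound is a power of `|n|`
  -- rather than of `1 + |n|`.
  refine ⟨fun n => ∑' k : ℕ, t (n + 1 + k), ⟨C * ((α - 1)⁻¹ * 2 ^ (α - 1)), fun n => ?_⟩,
    fun n => ?_⟩
  · have hC0 : 0 ≤ C := by
      have := (abs_nonneg _).trans (hC 0)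
      simpa using this
    have h2p : 1 ≤ (2 : ℝ) ^ (α - 1) := Real.one_le_rpow one_le_two hp.le
    rcases le_or_gt 0 n with hn | hn
    · have hn' : (0 : ℝ) ≤ n := by exact_mod_cast hn
      have h1 : ∀ k : ℕ, |t (n + 1 + k)| ≤ C * (1 + (n : ℝ) + k + 1) ^ (-(α - 1 + 1)) := fun k => by
        refine (hC _).trans_eq ?_
        rw [← hα']
        push_cast
        rw [abs_of_nonneg (by positivity)]
        congr 2; ring
      refine (abs_tsum_tail_le hp (by linarith) h1).trans ?_
      rw [abs_of_nonneg hn']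
      have h3 : 0 ≤ C * (α - 1)⁻¹ * (1 + (n : ℝ)) ^ (-(α - 1)) := by positivity
      nlinarith
    · have hn' : (n : ℝ) ≤ -1 := by exact_mod_cast Int.le_sub_one_of_lt hn
      have h1 : ∀ k : ℕ, |t (n - k)| ≤ C * (-(n : ℝ) + k + 1) ^ (-(α - 1 + 1)) := fun k => by
        refine (hC _).trans_eq ?_
        rw [← hα']
        push_cast
        have hk : (0 : ℝ) ≤ k := by positivity
        rw [abs_of_nonpos (by linarith)]
        congr 2; ring
      refine (congrArg abs (hsplit n)).trans_le ?_
      rw [abs_neg]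
      refine (abs_tsum_tail_le hp (by linarith) h1).trans ?_
      have h2 := rpow_neg_le_two_rpow_mul hp (show (1 : ℝ) ≤ -n by linarith)
      rw [abs_of_nonpos (by linarith), mul_assoc, mul_assoc]
      gcongr
  · simp only [sub_add_cancel]
    have h1 : Summable fun k : ℕ => t (n + k) :=
      hsum.comp_injective fun a b h => by simpa using h
    rw [h1.tsum_eq_zero_add]
    simp only [Nat.cast_zero, add_zero, Nat.cast_add, Nat.cast_one]
    rw [eq_sub_iff_add_eq]
    congr 1
    exact tsum_congr fun k => by congr 1; ring

theorem isFourier_sub_one_mul {s t : ℤ → ℝ} {h : ℂ → ℂ} (hs : IsFourier (fun n => (s n : ℂ)) h)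
    (hst : ∀ n, t n = s (n - 1) - s n) :
    IsFourier (fun n => (t n : ℂ)) (fun z => (z - 1) * h z) := by
  have h1 := ((hs.zpow_mul 1).add (hs.const_mul (-1))).congr (h' := fun z => (z - 1) * h z)
    fun z _ => by simp only [zpow_one]; ring
  convert! h1 using 2 with n
  rw [hst]; push_cast; ring

theorem sphere_subset_closure_diff_one :
    Metric.sphere (0 : ℂ) 1 ⊆ closure (Metric.sphere (0 : ℂ) 1 \ {1}) := by
  intro z hz
  by_cases h : z = 1
  · subst h
    have hlim : Tendsto (fun n : ℕ => Complex.exp (((1 / ((n : ℝ) + 1) : ℝ) : ℂ) * Complex.I)) atTop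
        (𝓝 1) := by
      have h1 : Continuous fun θ : ℝ => Complex.exp ((θ : ℂ) * Complex.I) := by fun_prop
      have h2 := (h1.tendsto 0).comp (tendsto_one_div_add_atTop_nhds_zero_nat (𝕜 := ℝ))
      rw [Complex.ofReal_zero, zero_mul, Complex.exp_zero] at h2
      exact h2
    refine mem_closure_of_tendsto hlim (Eventually.of_forall fun n => ⟨?_, fun h => ?_⟩)
    · rw [mem_sphere_zero_iff_norm]
      exact Complex.norm_exp_ofReal_mul_I _
    · have h3 := congrArg Complex.im (Set.mem_singleton_iff.mp h)
      rw [Complex.exp_ofReal_mul_I_im, Complex.one_im] at h3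
      have h4 : (0 : ℝ) < 1 / ((n : ℝ) + 1) := by positivity
      have h5 : 1 / ((n : ℝ) + 1) ≤ 1 := by
        rw [div_le_one (by positivity)]; linarith [n.cast_nonneg (α := ℝ)]
      exact (Real.sin_pos_of_pos_of_lt_pi h4 (by linarith [Real.pi_gt_three])).ne' h3
  · exact subset_closure ⟨hz, h⟩

/-- Dividing a symbol by `(z - 1)^d` costs `d` orders of decay of the couplings. -/
theorem exists_gap_couplings (d : ℕ) (α : ℝ) (t : ℤ → ℝ) (f : ℂ → ℂ) (hα : (d : ℝ) + 1 < α)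
    (ht : IsDecaying α t) (hf : ContinuousOn f (Metric.sphere 0 1))
    (h : ∀ z : ℂ, ‖z‖ = 1 → symbol t z = (z - 1) ^ d * f z) :
    ∃ s : ℤ → ℝ, IsDecaying (α - d) s ∧ ∀ z : ℂ, ‖z‖ = 1 → symbol s z = f z := by
  induction d generalizing α t with
  | zero => exact ⟨t, by simpa using ht, fun z hz => by simpa using h z hz⟩
  | succ d ih =>
    push_cast at hα
    have hd : (0 : ℝ) ≤ d := d.cast_nonneg
    have h0 : ∑' n, t n = 0 := by
      have h1 := h 1 norm_one
      simp only [symbol, one_zpow, mul_one, sub_self, ne_eq, Nat.add_eq_zero_iff, one_ne_zero,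
        and_false, not_false_eq_true, zero_pow, zero_mul] at h1
      rw [← Complex.ofReal_tsum] at h1
      exact_mod_cast h1
    obtain ⟨s, hs, hst⟩ := ht.exists_antidifference (by linarith) h0
    have hsF := isFourier_symbol (hs.summable (by linarith))
    have hsym : ∀ z : ℂ, ‖z‖ = 1 → symbol s z = (z - 1) ^ d * f z := by
      have key : Set.EqOn (symbol s) (fun z => (z - 1) ^ d * f z) (Metric.sphere 0 1) := by
        -- The factor `z - 1` cancels away from `1`; continuity of both sides gives the point `1`.
        refine Set.EqOn.of_subset_closure (s := Metric.sphere (0 : ℂ) 1 \ {1}) ?_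
          hsF.continuousOn (by fun_prop) Set.sdiff_subset sphere_subset_closure_diff_one
        rintro z ⟨hz, hz1⟩
        have hz' : ‖z‖ = 1 := by simpa using hz
        have h1 := symbol_eq_of_isFourier (isFourier_sub_one_mul hsF hst) hz'
        rw [h z hz', pow_succ', mul_assoc] at h1
        exact (mul_left_cancel₀ (sub_ne_zero.mpr hz1) h1).symm
      exact fun z hz => key (by simpa using hz)
    obtain ⟨s', hs', hs'f⟩ := ih (α - 1) s (by linarith) hs hsym
    refine ⟨s', ?_, hs'f⟩
    push_cast
    rwa [show α - (d + 1) = α - 1 - d by ring]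

/-! ### Wiener–Hopf factors -/

/-- For one-sided series the zeroth coefficient of the product is `h₀ h'₀`, here equal to `1`. This
is the nonzero diagonal used for independence. -/
theorem coeff_zero_ne_zero_of_mul_eq_one {h h' : ℂ → ℂ} {r r' : ℝ} (H : Wiener (Set.Ici 0) h r)
    (H' : Wiener (Set.Ici 0) h' r') (e : ∀ z : ℂ, ‖z‖ = 1 → h z * h' z = 1) : coeff h 0 ≠ 0 := by
  intro h0
  have h1 := (H.isFourier.mul H'.isFourier).1.congr (h' := fun _ => 1) fun z hz => (e z hz).symm
  have h2 := h1.coeff_eq 0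
  have h3 := coeff_zpow 0 0
  simp only [zpow_zero, if_true] at h3
  rw [h3] at h2
  refine one_ne_zero (h2.trans ((tsum_congr fun j => ?_).trans tsum_zero))
  rcases lt_trichotomy j 0 with hj | hj | hj
  · rw [H.coeff_eq_zero (by simpa using hj), zero_mul]
  · rw [hj, h0, zero_mul]
  · rw [H'.coeff_eq_zero (k := 0 - j) (by simpa using hj), mul_zero]

theorem summable_norm_neg_index {a : ℤ → ℂ} (ha : Summable fun k => ‖a k‖) :
    Summable fun k => ‖a (-k)‖ :=
  (Equiv.neg ℤ).summable_iff.mpr ha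

/-- The part `∑_{k ≥ 1} a_k z^k` of a Laurent series. -/
noncomputable def plusPart (a : ℤ → ℂ) (z : ℂ) : ℂ := ∑' k : ℕ, a ((k : ℤ) + 1) * z ^ (k + 1)

theorem isFourier_plusPart {a : ℤ → ℂ} (ha : Summable fun k => ‖a k‖) :
    IsFourier (fun k => if 0 < k then a k else 0) (plusPart a) := by
  refine .of_hasSum (.of_nonneg_of_le (fun _ => norm_nonneg _) (fun k => ?_) ha) fun z hz => ?_
  · split_ifs <;> simp
  · have hinj : Function.Injective fun k : ℕ => (k : ℤ) + 1 := fun a b h => by simpa using h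
    refine (hinj.hasSum_iff fun k hk => ?_).mp ?_
    · have : ¬0 < k := fun h => hk ⟨(k - 1).toNat, by simp only; omega⟩
      simp [this]
    · have h1 : Summable fun k : ℕ => a ((k : ℤ) + 1) * z ^ (k + 1) := by
        refine Summable.of_norm ?_
        simpa [hz] using! ha.comp_injective hinj
      convert! h1.hasSum using 2 with k
      have : (0 : ℤ) < k + 1 := by omega
      simp only [Function.comp, this, if_true]
      norm_cast

theorem Ici_zero_add_mem : ∀ a ∈ Set.Ici (0 : ℤ), ∀ b ∈ Set.Ici (0 : ℤ), a + b ∈ Set.Ici (0 : ℤ) :=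
  fun _ ha _ hb => Set.mem_Ici.mpr (add_nonneg ha hb)

theorem wiener_plusPart {a : ℤ → ℂ} (ha : Summable fun k => ‖a k‖) :
    ∃ r, Wiener (Set.Ici 0) (plusPart a) r := by
  refine ⟨_, _, isFourier_plusPart ha, fun k hk => if_neg fun h => hk h.le, le_rfl⟩

theorem wiener_exp_plusPart {a : ℤ → ℂ} (ha : Summable fun k => ‖a k‖) :
    ∃ r, Wiener (Set.Ici 0) (fun z => Complex.exp (plusPart a z)) r :=
  (wiener_plusPart ha).choose_spec.exp Set.self_mem_Ici Ici_zero_add_mem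

theorem wiener_inv_exp_plusPart {a : ℤ → ℂ} (ha : Summable fun k => ‖a k‖) :
    ∃ r, Wiener (Set.Ici 0) (fun z => 1 / Complex.exp (plusPart a z)) r := by
  obtain ⟨r, hr⟩ := wiener_plusPart ha
  obtain ⟨r', hr'⟩ := (hr.const_mul (-1)).exp Set.self_mem_Ici Ici_zero_add_mem
  exact ⟨r', hr'.congr fun z _ => by rw [neg_one_mul, Complex.exp_neg, one_div]⟩

theorem coeff_inv_exp_plusPart_ne_zero {a : ℤ → ℂ} (ha : Summable fun k => ‖a k‖) :
    coeff (fun z => 1 / Complex.exp (plusPart a z)) 0 ≠ 0 :=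
  coeff_zero_ne_zero_of_mul_eq_one (wiener_inv_exp_plusPart ha).choose_spec
    (wiener_exp_plusPart ha).choose_spec fun z _ => by
      rw [one_div, inv_mul_cancel₀ (Complex.exp_ne_zero _)]

theorem conj_inv_exp_plusPart {a : ℤ → ℂ} (ha : Summable fun k => ‖a k‖)
    (hreal : ∀ k ≠ 0, (starRingEnd ℂ) (a k) = a k) {z : ℂ} (hz : ‖z‖ = 1) :
    (starRingEnd ℂ) (1 / Complex.exp (plusPart a ((starRingEnd ℂ) z))) =
      1 / Complex.exp (plusPart a z) := by
  have h1 := isFourier_plusPart ha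
  have h2 : (starRingEnd ℂ) (plusPart a ((starRingEnd ℂ) z)) = plusPart a z := by
    rw [h1.conj.eq_tsum z hz, h1.eq_tsum z hz]
    refine tsum_congr fun k => ?_
    congr 1
    split_ifs with hk
    · exact hreal k hk.ne'
    · simp
  rw [map_div₀, map_one, ← Complex.exp_conj, h2]

/-- Reflection turns `b₋` into a factor with exponents `≥ 0`, so both species use the same one-sided
lemmas. -/
theorem bMinus_one_div (V : ℂ → ℂ) (z : ℂ) :
    bMinus V (1 / z) = Complex.exp (plusPart (fun k => coeff V (-k)) z) := by
  unfold bMinus plusPart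
  congr 1
  exact tsum_congr fun k => by simp

theorem Wiener.inv_arg {h : ℂ → ℂ} {r : ℝ} (H : Wiener (Set.Ici 0) h r) :
    Wiener (Set.Iic 0) (fun z => h (1 / z)) r := by
  obtain ⟨c, h1, h2, h3⟩ := H
  refine ⟨_, h1.inv_arg, fun k hk => h2 _ (by simp at *; omega), ?_⟩
  exact ((Equiv.neg ℤ).tsum_eq fun k => ‖c k‖).trans_le h3

theorem Wiener.mul_Iic {h h' : ℂ → ℂ} {r r' : ℝ} {a b : ℤ} (H : Wiener (Set.Iic a) h r)
    (H' : Wiener (Set.Iic b) h' r') : Wiener (Set.Iic (a + b)) (fun z => h z * h' z) (r * r') := by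
  refine (H.mul H').mono ?_ le_rfl
  rintro _ ⟨x, hx, y, hy, rfl⟩
  exact Set.mem_Iic.mpr (add_le_add (Set.mem_Iic.mp hx) (Set.mem_Iic.mp hy))

theorem Wiener.monomial_Iic {j a : ℤ} (h : j ≤ a) : Wiener (Set.Iic a) (fun z => z ^ j) 1 :=
  (Wiener.monomial j).mono (by simpa using h) le_rfl

theorem eq_add_plusPart {V : ℂ → ℂ} {R : ℝ} (hV : Wiener Set.univ V R) {z : ℂ} (hz : ‖z‖ = 1) :
    V z = coeff V 0 + plusPart (coeff V) z + plusPart (fun k => coeff V (-k)) (1 / z) := by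
  have hs := hV.isFourier.summable
  have h0 : IsFourier (fun k => if k = 0 then coeff V 0 else 0) fun _ => coeff V 0 := by
    refine .of_hasSum (summable_of_ne_finset_zero (s := {0}) fun k hk => ?_) fun z _ => ?_
    · rw [if_neg (by simpa using hk), norm_zero]
    · convert! hasSum_ite_eq (0 : ℤ) (coeff V 0) using 2 with k
      split_ifs with h <;> simp [h]
  have h1 := (h0.add (isFourier_plusPart hs)).add
    (isFourier_plusPart (summable_norm_neg_index hs)).inv_arg
  rw [hV.isFourier.eq_tsum z hz]
  refine Eq.trans (tsum_congr fun k => ?_) (h1.eq_tsum z hz).symm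
  congr 1
  rcases lt_trichotomy k 0 with h | h | h
  · simp [h, h.ne, h.not_gt]
  · simp [h]
  · simp [h, h.ne', h.not_gt]

theorem eq_wienerHopf {V f : ℂ → ℂ} {R : ℝ} {ω : ℤ} (hV : Wiener Set.univ V R)
    (he : ∀ z : ℂ, ‖z‖ = 1 → Complex.exp (V z) = z ^ (-ω) * f z) {z : ℂ} (hz : ‖z‖ = 1) :
    f z = Complex.exp (coeff V 0) * z ^ ω * bPlus V z * bMinus V z := by
  have h1 : bMinus V z = Complex.exp (plusPart (fun k => coeff V (-k)) (1 / z)) := by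
    rw [← bMinus_one_div, one_div_one_div]
  have h2 := he z hz
  rw [eq_add_plusPart hV hz, Complex.exp_add, Complex.exp_add, ← h1] at h2
  have h3 : z ^ ω * z ^ (-ω) = 1 := by
    rw [← zpow_add₀ (ne_zero_of_norm_one hz)]; simp
  change _ * bPlus V z * _ = _ at h2
  linear_combination (-f z) * h3 - z ^ ω * h2

/-! ### Edge modes of chains with symbol `P(z) f(z)` -/

section CriticalEdgeModes

variable {V f P : ℂ → ℂ} {R R' : ℝ} {ω D : ℤ} {t : ℤ → ℝ} {K : ℕ} {g : Fin K → ℕ → ℝ}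

/-- Multiplying `P f` by `1/b₊` leaves `e^{V₀} P z^ω b₋`, with exponents at most `D + ω`. -/
theorem hasEdgeModes_majB_of_wienerHopf (hV : Wiener Set.univ V R)
    (hf : ∀ z : ℂ, ‖z‖ = 1 →
      f z = Complex.exp (coeff V 0) * z ^ ω * bPlus V z * bMinus V z)
    (hP : Wiener (Set.Iic D) P R') (ht : IsFourier (fun n => (t n : ℂ)) fun z => P z * f z)
    (hK : ∀ m : ℕ, m < K → D + ω + m < 0)
    (hg : AreShiftedCoeffs (fun z => 1 / bPlus V z) g) : HasEdgeModes majB t g := by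
  have hs := hV.isFourier.summable
  obtain ⟨r, hr⟩ := wiener_inv_exp_plusPart hs
  obtain ⟨r', hr'⟩ := wiener_exp_plusPart (summable_norm_neg_index hs)
  have hp := (hP.mul_Iic (Wiener.monomial_Iic (le_refl ω))).mul_Iic
    (hr'.inv_arg.const_mul (Complex.exp (coeff V 0)))
  refine hasEdgeModes_majB_of_wiener (L := D + ω) ht hr (coeff_inv_exp_plusPart_ne_zero hs)
    ((hp.congr fun z hz => ?_).mono (by simp) le_rfl) hK hg
  have h1 : bMinus V z = Complex.exp (plusPart (fun k => coeff V (-k)) (1 / z)) := by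
    rw [← bMinus_one_div, one_div_one_div]
  change P z * f z * (1 / bPlus V z) = P z * z ^ ω *
    (Complex.exp (coeff V 0) * Complex.exp (plusPart (fun k => coeff V (-k)) (1 / z)))
  have h2 : bPlus V z ≠ 0 := Complex.exp_ne_zero _
  rw [hf z hz, ← h1]
  field_simp

/-- After `z ↦ 1/z` the roles of `b₊` and `b₋` are exchanged, and `D` bounds the exponents of
`P(1/z)`. For polynomial `P` one may take `D = 0`. -/
theorem hasEdgeModes_majA_of_wienerHopf (hV : Wiener Set.univ V R)
    (hf : ∀ z : ℂ, ‖z‖ = 1 →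
      f z = Complex.exp (coeff V 0) * z ^ ω * bPlus V z * bMinus V z)
    (hP : Wiener (Set.Iic D) (fun z => P (1 / z)) R')
    (ht : IsFourier (fun n => (t n : ℂ)) fun z => P z * f z)
    (hK : ∀ m : ℕ, m < K → D - ω + m < 0)
    (hg : AreShiftedCoeffs (fun z => 1 / bMinus V (1 / z)) g) : HasEdgeModes majA t g := by
  have hs := hV.isFourier.summable
  have hs' := summable_norm_neg_index hs
  obtain ⟨r, hr⟩ := wiener_inv_exp_plusPart hs'
  obtain ⟨r', hr'⟩ := wiener_exp_plusPart hs
  simp only [bMinus_one_div] at hg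
  have hp := (hP.mul_Iic (Wiener.monomial_Iic (le_refl (-ω)))).mul_Iic
    (hr'.inv_arg.const_mul (Complex.exp (coeff V 0)))
  refine hasEdgeModes_majA_of_wiener (L := D - ω) ht hr (coeff_inv_exp_plusPart_ne_zero hs')
    ((hp.congr fun z hz => ?_).mono (by simp [sub_eq_add_neg]) le_rfl) hK hg
  change P (1 / z) * f (1 / z) * (1 / Complex.exp (plusPart (fun k => coeff V (-k)) z)) =
    P (1 / z) * z ^ (-ω) * (Complex.exp (coeff V 0) * bPlus V (1 / z))
  rw [hf (1 / z) (by simp [hz]), bMinus_one_div]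
  have h2 := Complex.exp_ne_zero (plusPart (fun k => coeff V (-k)) z)
  have h3 : (1 / z) ^ ω = z ^ (-ω) := by simp
  rw [h3]
  field_simp

end CriticalEdgeModes

theorem wiener_sub_one_pow (d : ℕ) : ∃ r, Wiener (Set.Iic (d : ℤ)) (fun z => (z - 1) ^ d) r := by
  induction d with
  | zero => exact ⟨_, by simpa using Wiener.const (M := Set.Iic 0) 1 (by simp)⟩
  | succ d ih =>
    obtain ⟨r, hr⟩ := ih
    have h1 : Wiener (Set.Iic 1) (fun z => z ^ (1 : ℤ) + -1) (1 + ‖(-1 : ℂ)‖) :=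
      (Wiener.monomial_Iic le_rfl).add (Wiener.const (-1) (by simp))
    refine ⟨_, ((hr.mul_Iic h1).congr fun z _ => ?_)⟩
    rw [pow_succ, zpow_one, sub_eq_add_neg]

theorem wiener_one_div_sub_one_pow (d : ℕ) :
    ∃ r, Wiener (Set.Iic 0) (fun z => (1 / z - 1) ^ d) r := by
  have h1 : Wiener (Set.Iic 0) (fun z => z ^ (-1 : ℤ) + -1) (1 + ‖(-1 : ℂ)‖) :=
    (Wiener.monomial_Iic (by norm_num)).add (Wiener.const (-1) (by simp))
  refine ⟨_, (h1.pow (by simp) (fun a ha b hb => Set.mem_Iic.mpr (add_nonpos ha hb)) d).congr fun z _ => ?_⟩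
  rw [zpow_neg_one, sub_eq_add_neg, one_div]

/-- The critical chain is the case `P = (z-1)^d` and the gapped ones are `P = z^j`, with a common
`D`: zero for `γ` modes and `d` for `γ̃` modes. The index types are empty when the winding number
has the wrong sign or is too small, so no case split is needed. -/
theorem critical_chains (d : ℕ) (α : ℝ) (t : ℤ → ℝ) (fgap : ℂ → ℂ) (ω : ℤ)
    (hα : (d : ℝ) + 1 < α) (ht : IsDecaying α t) (hgap : Gapped fgap)
    (hω : HasWindingNumber fgap ω)
    (h : ∀ z : ℂ, ‖z‖ = 1 → symbol t z = (z - 1) ^ d * fgap z) :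
    ∃ s : ℤ → ℝ, IsDecaying (α - d) s ∧
      (∀ z : ℂ, ‖z‖ = 1 → symbol s z = fgap z) ∧
      ∃ V : ℂ → ℂ, IsWienerHopfLog fgap ω V ∧
        (∀ z : ℂ, ‖z‖ = 1 →
          fgap z = Complex.exp (coeff V 0) * z ^ ω * bPlus V z * bMinus V z) ∧
        (∃ g : Fin ω.toNat → ℕ → ℝ,
          AreShiftedCoeffs (fun z => 1 / bMinus V (1 / z)) g ∧
          HasEdgeModes majA t g ∧
          ∀ j : ℕ, j ≤ d → HasEdgeModes majA (shift j s) g) ∧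
        (∃ g : Fin (-ω - (d : ℤ)).toNat → ℕ → ℝ,
          AreShiftedCoeffs (fun z => 1 / bPlus V z) g ∧
          HasEdgeModes majB t g ∧
          ∀ j : ℕ, j ≤ d → HasEdgeModes majB (shift j s) g) := by
  obtain ⟨s, hs, hsf⟩ := exists_gap_couplings d α t fgap hα ht hgap.1 h
  have hd : (0 : ℝ) ≤ d := d.cast_nonneg
  have hsF : IsFourier (fun n => (s n : ℂ)) fgap :=
    (isFourier_symbol (hs.summable (by linarith))).congr fun z hz => (hsf z hz).symm
  have htF : IsFourier (fun n => (t n : ℂ)) fun z => (z - 1) ^ d * fgap z :=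
    (isFourier_symbol (ht.summable (by linarith))).congr fun z hz => (h z hz).symm
  obtain ⟨V, R, hV, he⟩ := exists_wiener_log (Wiener.of_isFourier hsF) hgap hω
  have hsV := hV.isFourier.summable
  have hfac : ∀ z : ℂ, ‖z‖ = 1 →
      fgap z = Complex.exp (coeff V 0) * z ^ ω * bPlus V z * bMinus V z :=
    fun z hz => eq_wienerHopf hV he hz
  have hreal : ∀ k ≠ 0, (starRingEnd ℂ) (coeff V k) = coeff V k := fun k hk => by
    refine coeff_log_real hV he (fun z hz => ?_) hk
    have h1 := hsF.conj.eq_tsum z hz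
    simp only [Complex.conj_ofReal] at h1
    rw [map_mul, h1, ← hsF.eq_tsum z hz, map_zpow₀, Complex.conj_conj]
  obtain ⟨r₁, hr₁⟩ := wiener_inv_exp_plusPart (summable_norm_neg_index hsV)
  obtain ⟨r₂, hr₂⟩ := wiener_inv_exp_plusPart hsV
  obtain ⟨p, hp⟩ := wiener_sub_one_pow d
  obtain ⟨p', hp'⟩ := wiener_one_div_sub_one_pow d
  refine ⟨s, hs, hsf, V, ⟨hV.isFourier.continuousOn, he, hsV⟩, hfac, ?_, ?_⟩
  · obtain ⟨g, hg⟩ := exists_areShiftedCoeffs hr₁ (fun z hz => conj_inv_exp_plusPart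
      (summable_norm_neg_index hsV) (fun k hk => hreal (-k) (neg_ne_zero.mpr hk)) hz)
      ω.toNat
    have hg' : AreShiftedCoeffs (fun z => 1 / bMinus V (1 / z)) g := by
      simpa only [bMinus_one_div] using! hg
    refine ⟨g, hg', hasEdgeModes_majA_of_wienerHopf (D := 0) hV hfac hp' htF
      (fun m hm => by omega) hg', fun j _ => ?_⟩
    refine hasEdgeModes_majA_of_wienerHopf (D := 0) (P := fun z => z ^ (j : ℤ)) hV hfac
      ((Wiener.monomial_Iic (j := -j) (by omega)).congr fun z _ => by simp) (hsF.zpow_mul j)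
      (fun m hm => by omega) hg'
  · obtain ⟨g, hg⟩ := exists_areShiftedCoeffs hr₂ (fun z hz => conj_inv_exp_plusPart hsV hreal hz)
      (-ω - (d : ℤ)).toNat
    refine ⟨g, hg, hasEdgeModes_majB_of_wienerHopf hV hfac hp htF (fun m hm => by omega) hg,
      fun j hj => ?_⟩
    exact hasEdgeModes_majB_of_wienerHopf (P := fun z => z ^ (j : ℤ)) hV hfac
      (Wiener.monomial_Iic (j := j) (a := d) (by omega)) (hsF.zpow_mul j)
      (fun m hm => by omega) hg

/-! ### The interpolating family of polylogarithmic chains -/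

theorem hasSum_zetaReal {s : ℝ} (hs : 1 < s) :
    HasSum (fun n : ℕ => ((n : ℝ) + 1) ^ (-s)) (zetaReal s) := by
  have hsum : Summable fun n : ℕ => ((n : ℝ) + 1) ^ (-s) := by
    have h1 := (summable_nat_add_iff 1).mpr (Real.summable_nat_rpow.mpr (neg_lt_neg hs))
    exact h1.congr fun n => by push_cast; rfl
  have h : riemannZeta s = ((∑' n : ℕ, ((n : ℝ) + 1) ^ (-s) : ℝ) : ℂ) := by
    rw [zeta_eq_tsum_one_div_nat_add_one_cpow (by simpa using hs), Complex.ofReal_tsum]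
    refine tsum_congr fun n => ?_
    have hn : (0 : ℝ) ≤ (n : ℝ) + 1 := by positivity
    rw [Complex.ofReal_cpow hn, Complex.ofReal_neg, Complex.cpow_neg, one_div]
    push_cast
    rfl
  rw [zetaReal, h, Complex.ofReal_re]
  exact hsum.hasSum

theorem zetaReal_pos {s : ℝ} (hs : 1 < s) : 0 < zetaReal s := by
  have h := hasSum_zetaReal hs
  have h1 := h.summable.le_tsum 0 fun n _ => by positivity
  rw [h.tsum_eq] at h1
  exact lt_of_lt_of_le (by norm_num) h1

/-- The couplings of the polylogarithm. -/
noncomputable def liCoupling (s : ℝ) (n : ℤ) : ℝ := if 0 < n then |(n : ℝ)| ^ (-s) else 0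

theorem isFourier_polylog {s : ℝ} (hs : 1 < s) :
    IsFourier (fun n => (liCoupling s n : ℂ)) (polylog s) := by
  have h := isFourier_plusPart (a := fun n => ((|(n : ℝ)| ^ (-s) : ℝ) : ℂ)) (by
    refine (Real.summable_abs_int_rpow hs).congr fun n => ?_
    rw [Complex.norm_real, Real.norm_of_nonneg (Real.rpow_nonneg (abs_nonneg _) _)])
  have h1 : (fun n => (liCoupling s n : ℂ)) =
      fun n : ℤ => if 0 < n then ((|(n : ℝ)| ^ (-s) : ℝ) : ℂ) else 0 := by
    funext n
    unfold liCoupling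
    split_ifs <;> simp
  rw [h1]
  refine h.congr fun z _ => tsum_congr fun k => ?_
  have hk : (0 : ℝ) ≤ (k : ℝ) + 1 := by positivity
  rw [div_eq_inv_mul, ← Complex.ofReal_inv, ← Real.rpow_neg hk]
  push_cast [abs_of_nonneg hk]
  rfl

theorem norm_polylog_le {s : ℝ} (hs : 1 < s) {z : ℂ} (hz : ‖z‖ = 1) :
    ‖polylog s z‖ ≤ zetaReal s := by
  refine tsum_of_norm_bounded (hasSum_zetaReal hs) fun k => ?_
  have hk : (0 : ℝ) ≤ (k : ℝ) + 1 := by positivity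
  rw [norm_div, norm_pow, hz, one_pow, Complex.norm_real, Real.norm_eq_abs,
    abs_of_nonneg (by positivity), Real.rpow_neg hk, one_div]

theorem polylog_one {s : ℝ} (hs : 1 < s) : polylog s 1 = zetaReal s := by
  rw [← (hasSum_zetaReal hs).tsum_eq, Complex.ofReal_tsum]
  refine tsum_congr fun k => ?_
  have hk : (0 : ℝ) ≤ (k : ℝ) + 1 := by positivity
  rw [one_pow, one_div, ← Complex.ofReal_inv, ← Real.rpow_neg hk]

/-! ### Stability of decay under sums, multiples and shifts -/

theorem IsDecaying.add {α : ℝ} {s t : ℤ → ℝ} (hs : IsDecaying α s) (ht : IsDecaying α t) :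
    IsDecaying α fun n => s n + t n := by
  obtain ⟨C, hC⟩ := hs
  obtain ⟨D, hD⟩ := ht
  exact ⟨C + D, fun n => (abs_add_le _ _).trans (by rw [add_mul]; exact add_le_add (hC n) (hD n))⟩

theorem IsDecaying.const_mul {α : ℝ} {t : ℤ → ℝ} (ht : IsDecaying α t) (a : ℝ) :
    IsDecaying α fun n => a * t n := by
  obtain ⟨C, hC⟩ := ht
  refine ⟨|a| * C, fun n => ?_⟩
  rw [abs_mul, mul_assoc]
  exact mul_le_mul_of_nonneg_left (hC n) (abs_nonneg a)

theorem IsDecaying.mono {α α' : ℝ} {t : ℤ → ℝ} (ht : IsDecaying α t) (h : α' ≤ α) :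
    IsDecaying α' t := by
  obtain ⟨C, hC⟩ := ht
  have hC0 : 0 ≤ C := by
    have := (abs_nonneg _).trans (hC 0)
    simpa using this
  refine ⟨C, fun n => (hC n).trans (mul_le_mul_of_nonneg_left ?_ hC0)⟩
  exact Real.rpow_le_rpow_of_exponent_le (by linarith [abs_nonneg (n : ℝ)]) (by linarith)

theorem IsDecaying.shift {α : ℝ} {t : ℤ → ℝ} (ht : IsDecaying α t) (hα : 0 ≤ α) (j : ℤ) :
    IsDecaying α (shift j t) := by
  obtain ⟨C, hC⟩ := ht
  have hC0 : 0 ≤ C := by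
    have := (abs_nonneg _).trans (hC 0)
    simpa using this
  refine ⟨C * (1 + |(j : ℝ)|) ^ α, fun n => (hC (n - j)).trans ?_⟩
  rw [mul_assoc]
  refine mul_le_mul_of_nonneg_left ?_ hC0
  push_cast
  have hj := abs_nonneg (j : ℝ)
  have hnj := abs_nonneg ((n : ℝ) - j)
  have h1 : 1 + |(n : ℝ)| ≤ (1 + |(j : ℝ)|) * (1 + |(n : ℝ) - j|) := by
    have := abs_add_le ((n : ℝ) - j) j
    rw [sub_add_cancel] at this
    nlinarith
  have h2 := Real.rpow_le_rpow_of_nonpos (show 0 < 1 + |(n : ℝ)| by positivity) h1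
    (neg_nonpos.mpr hα)
  rw [Real.mul_rpow (by positivity) (by positivity)] at h2
  have h3 := mul_le_mul_of_nonneg_left h2 (show 0 ≤ (1 + |(j : ℝ)|) ^ α by positivity)
  rwa [← mul_assoc, ← Real.rpow_add (by positivity), add_neg_cancel, Real.rpow_zero,
    one_mul] at h3

theorem isDecaying_single (α : ℝ) (a : ℝ) : IsDecaying α fun n => if n = 0 then a else 0 := by
  refine ⟨|a|, fun n => ?_⟩
  dsimp only
  split_ifs with h
  · simp [h]
  · rw [abs_zero]; positivity

theorem isDecaying_liCoupling {s : ℝ} (hs : 0 < s) : IsDecaying s (liCoupling s) := by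
  refine ⟨2 ^ s, fun n => ?_⟩
  unfold liCoupling
  split_ifs with h
  · rw [abs_of_nonneg (by positivity)]
    have h1 : (1 : ℝ) ≤ n := by exact_mod_cast h
    exact rpow_neg_le_two_rpow_mul hs (h1.trans (le_abs_self _))
  · rw [abs_zero]; positivity

/-! ### The critical point of the interpolation and its quotient by `z - 1` -/

/-- The couplings of `(z - 1) f_g(z)`. -/
noncomputable def interpCoupling (a β γ : ℝ) (n : ℤ) : ℝ :=
  shift 1 (fun n => (if n = 0 then 1 else 0) + a * liCoupling β n) n +
    -1 * ((if n = 0 then 1 else 0) + a * (zetaReal β / zetaReal γ) * liCoupling γ n)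

theorem isDecaying_interpCoupling {a β γ : ℝ} (hβ : 2 < β) (hγ : 2 < γ) :
    IsDecaying (min β γ) (interpCoupling a β γ) := by
  have h0 : 0 ≤ min β γ := le_min (by linarith) (by linarith)
  exact (((isDecaying_single _ 1).add (((isDecaying_liCoupling (by linarith)).mono
    (min_le_left β γ)).const_mul a)).shift h0 1).add (((isDecaying_single _ 1).add
      (((isDecaying_liCoupling (by linarith)).mono (min_le_right β γ)).const_mul _)).const_mul _)

theorem isFourier_single (a : ℝ) :
    IsFourier (fun n => ((if n = 0 then a else 0 : ℝ) : ℂ)) fun _ => a := by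
  refine .of_hasSum (summable_of_ne_finset_zero (s := {0}) fun k hk => ?_) fun z _ => ?_
  · rw [if_neg (by simpa using hk)]; simp
  · convert! hasSum_ite_eq (0 : ℤ) (a : ℂ) using 2 with k
    split_ifs with h <;> simp [h]

theorem isFourier_interpCoupling {a β γ : ℝ} (hβ : 2 < β) (hγ : 2 < γ) :
    IsFourier (fun n => (interpCoupling a β γ n : ℂ)) fun z => 2 * interp a β γ (1 / 2) z := by
  have h1 := ((isFourier_single 1).add
    ((isFourier_polylog (show 1 < β by linarith)).const_mul a)).zpow_mul 1
  have h2 := ((isFourier_single 1).add ((isFourier_polylog (show 1 < γ by linarith)).const_mul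
    (a * (zetaReal β / zetaReal γ) : ℝ))).const_mul (-1)
  have h3 := (h1.add h2).congr (h' := fun z => 2 * interp a β γ (1 / 2) z) fun z _ => by
    unfold interp
    push_cast
    rw [zpow_one]
    ring
  convert! h3 using 2 with n
  unfold interpCoupling shift
  push_cast
  rfl

theorem harmonicNumber_succ (s : ℝ) (n : ℕ) :
    harmonicNumber s (n + 1) = harmonicNumber s n + ((n : ℝ) + 1) ^ (-s) := by
  unfold harmonicNumber
  rw [Finset.sum_Icc_succ_top (by omega)]
  push_cast
  rfl

theorem harmonicNumber_zero (s : ℝ) : harmonicNumber s 0 = 0 := by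
  simp [harmonicNumber]

/-- Summation by parts: consecutive harmonic numbers differ by one power. The case `n = 1` is
separate because `gapCoupling` at `0` is set to `1`. -/
theorem interpCoupling_eq (a β γ : ℝ) (n : ℤ) :
    interpCoupling a β γ n = gapCoupling a β γ (n - 1) - gapCoupling a β γ n := by
  unfold interpCoupling shift liCoupling
  rcases lt_trichotomy n 0 with hn | rfl | hn
  · have h1 : n - 1 < 0 := by omega
    have h2 : n - 1 ≠ 0 := by omega
    have h3 : ¬0 < n - 1 := by omega
    simp only [gapCoupling, hn, h1, h2, h3, hn.ne, hn.not_gt, if_true, if_false]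
    ring
  · simp [gapCoupling]
  · obtain ⟨k, rfl⟩ : ∃ k : ℕ, n = k + 1 := ⟨(n - 1).toNat, by omega⟩
    have h1 : ∀ k : ℕ, gapCoupling a β γ ((k : ℤ) + 1) =
        -a * (harmonicNumber β k - zetaReal β / zetaReal γ * harmonicNumber γ (k + 1)) := fun k => by
      have h2 : ¬(k : ℤ) + 1 < 0 := by omega
      have h3 : (k : ℤ) + 1 ≠ 0 := by omega
      have h4 : ((k : ℤ) + 1).toNat = k + 1 := by omega
      simp only [gapCoupling, h2, h3, h4, if_false, Nat.add_sub_cancel]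
    rw [h1, add_sub_cancel_right]
    have h3 : (k : ℤ) + 1 ≠ 0 := by omega
    have hk : (0 : ℝ) ≤ (k : ℝ) + 1 := by positivity
    simp only [h3, hn, if_true, if_false]
    push_cast
    rw [abs_of_nonneg hk]
    rcases k with _ | k
    · simp [gapCoupling, harmonicNumber_succ, harmonicNumber_zero, sub_eq_add_neg]
    · have h4 := h1 k
      have h5 : (0 : ℤ) < (k + 1 : ℕ) := by omega
      have h6 : ((k + 1 : ℕ) : ℤ) ≠ 0 := by omega
      have h7 : (0 : ℝ) ≤ (k : ℝ) + 1 := by positivity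
      simp only [h5, h6, if_true, if_false]
      push_cast
      rw [h4, harmonicNumber_succ γ (k + 1), harmonicNumber_succ β k, abs_of_nonneg h7]
      push_cast
      ring

theorem interp_half_one {a β γ : ℝ} (hβ : 2 < β) (hγ : 2 < γ) : interp a β γ (1 / 2) 1 = 0 := by
  have hz := (zetaReal_pos (show 1 < γ by linarith)).ne'
  have hz' : (zetaReal γ : ℂ) ≠ 0 := by exact_mod_cast hz
  unfold interp
  rw [polylog_one (by linarith), polylog_one (by linarith)]
  push_cast
  field_simp
  ring

/-- No harmonic sums are estimated. The decaying antidifference `s` has the same differences as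
`gapCoupling`, so the two differ by a constant. At negative sites `gapCoupling` is zero, so `s`
equals that constant there, and summability makes it zero. -/
theorem isDecaying_gapCoupling {a β γ : ℝ} (hβ : 2 < β) (hγ : 2 < γ) :
    IsDecaying (min β γ - 1) (gapCoupling a β γ) := by
  have hμ : 2 < min β γ := lt_min hβ hγ
  have h0 : ∑' n, interpCoupling a β γ n = 0 := by
    have h1 := (isFourier_interpCoupling (a := a) hβ hγ).eq_tsum 1 norm_one
    simp only [interp_half_one hβ hγ, one_zpow, mul_one, mul_zero] at h1
    rw [← Complex.ofReal_tsum] at h1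
    exact_mod_cast h1.symm
  obtain ⟨s, hs, hst⟩ := (isDecaying_interpCoupling (a := a) hβ hγ).exists_antidifference
    (by linarith) h0
  have hstep : ∀ n, s n - gapCoupling a β γ n = s (n - 1) - gapCoupling a β γ (n - 1) := fun n => by
    have h1 := hst n
    rw [interpCoupling_eq] at h1
    linarith
  have hconst : ∀ n, s n - gapCoupling a β γ n = s 0 - gapCoupling a β γ 0 := fun n => by
    induction n with
    | zero => rfl
    | succ n ih => rw [hstep, add_sub_cancel_right]; exact ih
    | pred n ih => rw [← ih, hstep (-(n : ℤ))]
  have hneg : ∀ k : ℕ, s (-(k : ℤ) - 1) = s 0 - gapCoupling a β γ 0 := fun k => by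
    have h1 : -(k : ℤ) - 1 < 0 := by omega
    rw [← hconst (-(k : ℤ) - 1)]
    simp only [gapCoupling, h1, if_true, sub_zero]
  have hc : s 0 - gapCoupling a β γ 0 = 0 := by
    have h1 := (hs.summable (by linarith)).comp_injective
      (i := fun k : ℕ => -(k : ℤ) - 1) fun a b h => by simpa using h
    simp only [Function.comp_def, hneg] at h1
    simpa using h1.tendsto_atTop_zero
  have : gapCoupling a β γ = s := funext fun n => by linarith [hconst n]
  rwa [this]

theorem isFourier_gapCoupling {a β γ : ℝ} (hβ : 2 < β) (hγ : 2 < γ) :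
    IsFourier (fun n => (gapCoupling a β γ n : ℂ)) (symbol (gapCoupling a β γ)) :=
  isFourier_symbol ((isDecaying_gapCoupling hβ hγ).summable (by linarith [lt_min hβ hγ]))

theorem interp_half_eq {a β γ : ℝ} (hβ : 2 < β) (hγ : 2 < γ) {z : ℂ} (hz : ‖z‖ = 1) :
    interp a β γ (1 / 2) z = (1 / 2) * ((z - 1) * symbol (gapCoupling a β γ) z) := by
  have h1 := isFourier_sub_one_mul (isFourier_gapCoupling (a := a) hβ hγ) (interpCoupling_eq a β γ)
  have h2 := (isFourier_interpCoupling (a := a) hβ hγ).eq_tsum z hz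
  rw [← h1.eq_tsum z hz] at h2
  rw [← h2]; ring

/-- A monomial times a perturbation of `1` is gapped, with the winding number of the monomial. -/
theorem gapped_and_windingNumber {f x : ℂ → ℂ} {c : ℂ} (n : ℤ) (hc : c ≠ 0)
    (hx : ContinuousOn x (Metric.sphere 0 1)) (hlt : ∀ z : ℂ, ‖z‖ = 1 → ‖x z‖ < 1)
    (hf : ∀ z : ℂ, ‖z‖ = 1 → f z = c * z ^ n * (1 + x z)) : Gapped f ∧ HasWindingNumber f n := by
  have hslit : ∀ z : ℂ, ‖z‖ = 1 → 1 + x z ∈ Complex.slitPlane := fun z hz =>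
    Complex.mem_slitPlane_of_norm_lt_one (hlt z hz)
  -- The principal argument of `1 + x` is continuous because `|x| < 1` keeps it in the slit plane.
  -- Its increase over a period is zero, so only `n θ` contributes.
  refine ⟨⟨?_, fun z hz => ?_⟩, fun θ => c.arg + n * θ +
    (1 + x (Complex.exp (θ * Complex.I))).arg, ?_, fun θ => ?_, ?_⟩
  · have h1 : ContinuousOn (fun z : ℂ => c * z ^ n * (1 + x z)) (Metric.sphere 0 1) := by
      refine (continuousOn_const.mul fun z hz => ?_).mul (continuousOn_const.add hx)
      exact (continuousAt_zpow₀ z n (Or.inl (ne_zero_of_norm_one (by simpa using hz)))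
        ).continuousWithinAt
    exact h1.congr fun z hz => hf z (by simpa using hz)
  · rw [hf z hz]
    exact mul_ne_zero (mul_ne_zero hc (zpow_ne_zero _ (ne_zero_of_norm_one hz)))
      (Complex.slitPlane_ne_zero (hslit z hz))
  · refine Continuous.add (by fun_prop) ?_
    rw [continuous_iff_continuousAt]
    intro θ
    have h1 : Continuous fun θ : ℝ => 1 + x (Complex.exp (θ * Complex.I)) :=
      continuous_const.add (hx.comp_continuous (by fun_prop) fun θ => by simp)
    exact (Complex.continuousAt_arg (hslit _ (Complex.norm_exp_ofReal_mul_I θ))).comp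
      (f := fun θ : ℝ => 1 + x (Complex.exp (θ * Complex.I))) h1.continuousAt
  · have hu := Complex.norm_exp_ofReal_mul_I θ
    rw [hf _ hu, norm_mul, norm_mul, norm_zpow, hu, one_zpow, mul_one]
    have h1 := Complex.norm_mul_exp_arg_mul_I c
    have h2 := Complex.norm_mul_exp_arg_mul_I (1 + x (Complex.exp (θ * Complex.I)))
    rw [← Complex.exp_int_mul]
    conv_lhs => rw [← h1, ← h2]
    push_cast
    rw [add_mul, add_mul, Complex.exp_add, Complex.exp_add, mul_assoc (n : ℂ)]
    ring
  · have h1 : Complex.exp ((2 * Real.pi : ℝ) * Complex.I) = Complex.exp ((0 : ℝ) * Complex.I) := by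
      push_cast
      rw [Complex.exp_two_pi_mul_I]; simp
    simp only [h1]
    ring

theorem interp_example (β γ : ℝ) (hβ : 2 < β) (hγ : 2 < γ) :
    (∀ a : ℝ, IsDecaying (min β γ - 1) (gapCoupling a β γ) ∧
      ∀ z : ℂ, ‖z‖ = 1 → interp a β γ (1 / 2) z =
        (1 / 2) * ((z - 1) * symbol (gapCoupling a β γ) z)) ∧
    ∃ a₀ : ℝ, 0 < a₀ ∧ ∀ a : ℝ, |a| < a₀ →
      (Gapped (interp a β γ 0) ∧ HasWindingNumber (interp a β γ 0) 0) ∧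
      (Gapped (interp a β γ 1) ∧ HasWindingNumber (interp a β γ 1) 1) ∧
      (∀ lam : ℝ, interp a β γ lam 1 = 0 ↔ lam = 1 / 2) ∧
      (Gapped (symbol (gapCoupling a β γ)) ∧
        HasWindingNumber (symbol (gapCoupling a β γ)) 0) ∧
      ∀ κ : ℤ, ∃ t : ℤ → ℝ, IsDecaying (min β γ) t ∧
        (∀ z : ℂ, ‖z‖ = 1 → symbol t z = z ^ κ * interp a β γ (1 / 2) z) ∧
        HasEdgeModes majA t
          (fun (m : Fin κ.toNat) (n : ℕ) => if n = (m : ℕ) then 1 else 0) ∧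
        ∃ g : Fin (-κ - 1).toNat → ℕ → ℝ,
          AreShiftedCoeffs (fun z => 1 / symbol (gapCoupling a β γ) z) g ∧
          HasEdgeModes majB t g ∧
          HasEdgeModes majB (shift κ (gapCoupling a β γ)) g ∧
          HasEdgeModes majB (shift (κ + 1) (gapCoupling a β γ)) g := by
  refine ⟨fun a => ⟨isDecaying_gapCoupling hβ hγ, fun z hz => interp_half_eq hβ hγ hz⟩, ?_⟩
  have hβ1 : 1 < β := by linarith
  have hγ1 : 1 < γ := by linarith
  have hζβ := zetaReal_pos hβ1
  have hζγ := zetaReal_pos hγ1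
  have hW : ∀ a, ∃ r, Wiener (Set.Ici 0) (symbol (gapCoupling a β γ)) r := fun a =>
    ⟨_, _, isFourier_gapCoupling hβ hγ, fun k hk => by
      have hk' : k < 0 := not_le.mp fun h => hk h
      simp [gapCoupling, hk'], le_rfl⟩
  obtain ⟨r, hr⟩ := hW 1
  have hx := hr.add (Wiener.const (-1) (Set.self_mem_Ici))
  set x : ℂ → ℂ := fun z => symbol (gapCoupling 1 β γ) z + -1
  set K : ℝ := r + ‖(-1 : ℂ)‖
  have hK := hx.nonneg
  -- The couplings of `f_g` are affine in `a`, so `x` and its Wiener norm bound `K` come from `a =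
  -- 1` and serve every `a`.
  have hsymb : ∀ (a : ℝ) (z : ℂ), ‖z‖ = 1 → symbol (gapCoupling a β γ) z = 1 + a * x z := by
    intro a z hz
    have h1 := (isFourier_single 1).add
      (((isFourier_gapCoupling (a := 1) hβ hγ).add ((isFourier_single 1).const_mul (-1))).const_mul
        (a : ℂ))
    have h2 := h1.eq_tsum z hz
    simp only [Complex.ofReal_one, mul_one] at h2
    rw [h2]
    refine tsum_congr fun n => ?_
    congr 1
    unfold gapCoupling
    split_ifs with h3 h4 <;> first | omega | (push_cast; ring)
  -- This gives `|a| ζ(β) < 1`, which handles `f_0` and `f_1` since `|b| ζ(γ) = |a| ζ(β)`, and `|a|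
  -- K < 1`, which handles `f_g`.
  refine ⟨(1 + zetaReal β + K)⁻¹, by positivity, fun a ha => ?_⟩
  have ha1 : |a| * (1 + zetaReal β + K) < 1 := by
    rwa [← lt_div_iff₀ (by positivity), one_div]
  have haβ : |a| * zetaReal β < 1 := by nlinarith [abs_nonneg a, mul_nonneg (abs_nonneg a) hK]
  have haK : |a| * K < 1 := by nlinarith [abs_nonneg a, mul_nonneg (abs_nonneg a) hζβ.le]
  have hna : ‖(a : ℂ)‖ = |a| := by rw [Complex.norm_real, Real.norm_eq_abs]
  have hgap : Gapped (symbol (gapCoupling a β γ)) ∧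
      HasWindingNumber (symbol (gapCoupling a β γ)) 0 := by
    refine gapped_and_windingNumber (x := fun z => a * x z) 0 one_ne_zero
      (continuousOn_const.mul hx.isFourier.continuousOn) (fun z hz => ?_) fun z hz => ?_
    · rw [norm_mul, hna]
      exact (mul_le_mul_of_nonneg_left (hx.norm_le hz) (abs_nonneg a)).trans_lt haK
    · rw [hsymb a z hz]; simp
  refine ⟨?_, ?_, fun lam => ?_, hgap, fun κ => ?_⟩
  · refine gapped_and_windingNumber (c := -1)
      (x := fun z => (a * (zetaReal β / zetaReal γ) : ℝ) * polylog γ z) 0 (by simp)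
      (continuousOn_const.mul (isFourier_polylog hγ1).continuousOn) (fun z hz => ?_) fun z hz => ?_
    · rw [norm_mul, Complex.norm_real, Real.norm_eq_abs, abs_mul,
        abs_of_nonneg (div_pos hζβ hζγ).le]
      refine (mul_le_mul_of_nonneg_left (norm_polylog_le hγ1 hz) (by positivity)).trans_lt ?_
      rwa [mul_assoc, div_mul_cancel₀ _ hζγ.ne']
    · unfold interp; simp
  · refine gapped_and_windingNumber (c := 1) (x := fun z => a * polylog β z) 1 one_ne_zero
      (continuousOn_const.mul (isFourier_polylog hβ1).continuousOn) (fun z hz => ?_) fun z hz => ?_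
    · rw [norm_mul, hna]
      exact (mul_le_mul_of_nonneg_left (norm_polylog_le hβ1 hz) (abs_nonneg a)).trans_lt haβ
    · unfold interp; simp
  · have h1 : interp a β γ lam 1 = (((2 * lam - 1) * (1 + a * zetaReal β) : ℝ) : ℂ) := by
      have hz' : (zetaReal γ : ℂ) ≠ 0 := by exact_mod_cast hζγ.ne'
      unfold interp
      rw [polylog_one hβ1, polylog_one hγ1]
      push_cast
      field_simp
      ring
    have h2 : 1 + a * zetaReal β ≠ 0 := by
      have := neg_abs_le a
      nlinarith
    rw [h1, Complex.ofReal_eq_zero, mul_eq_zero, or_iff_left h2]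
    constructor <;> intro h <;> linarith
  · have hF := isFourier_gapCoupling (a := a) hβ hγ
    have hμ : 0 ≤ min β γ := by linarith [lt_min hβ hγ]
    have ht := ((isFourier_sub_one_mul hF (interpCoupling_eq a β γ)).const_mul
      ((1 / 2 : ℝ) : ℂ)).zpow_mul κ
    set t : ℤ → ℝ := shift κ fun n => 1 / 2 * interpCoupling a β γ n with ht_def
    have htF : IsFourier (fun n => (t n : ℂ)) fun z => z ^ κ * (((1 / 2 : ℝ) : ℂ) *
        ((z - 1) * symbol (gapCoupling a β γ) z)) := by
      convert! ht using 2 with n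
      simp only [ht_def, shift]
      push_cast
      rfl
    obtain ⟨p, hp⟩ := wiener_sub_one_pow 1
    obtain ⟨p', hp'⟩ := wiener_one_div_sub_one_pow 1
    obtain ⟨ra, hra⟩ := hW a
    -- The Neumann series keeps exponents `≥ 0`, so `1/f_g` is already one-sided and no logarithm is
    -- required.
    obtain ⟨R, hR⟩ : ∃ R, Wiener (Set.Ici 0) (fun z => 1 / symbol (gapCoupling a β γ) z) R := by
      have h1 : ‖(-a : ℂ)‖ * K < 1 := by rwa [norm_neg, hna]
      obtain ⟨R, hR⟩ := (hx.const_mul (-a)).one_sub_inv Set.self_mem_Ici Ici_zero_add_mem h1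
      exact ⟨R, hR.congr fun z hz => by rw [hsymb a z hz, neg_mul, sub_neg_eq_add]⟩
    have hR0 := coeff_zero_ne_zero_of_mul_eq_one hR hra fun z hz =>
      one_div_mul_cancel (hgap.1.2 z hz)
    refine ⟨t, ((isDecaying_interpCoupling hβ hγ).const_mul _).shift hμ κ, fun z hz => ?_, ?_, ?_⟩
    · rw [symbol_eq_of_isFourier htF hz, interp_half_eq hβ hγ hz]
      push_cast
      rfl
    · have hprod := ((Wiener.monomial_Iic (le_refl (-κ))).mul_Iic
        (hp'.mul_Iic hra.inv_arg)).const_mul ((1 / 2 : ℝ) : ℂ)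
      -- The reflected symbol has only exponents `≤ -κ` by itself, so `h = 1` works and the modes
      -- sit on single sites.
      refine hasEdgeModes_majA_of_wiener (L := -κ) (h := fun _ => 1) htF
        (Wiener.const 1 Set.self_mem_Ici) ?_
        ((hprod.mono (M' := Set.Iic (-κ)) (by simp) le_rfl).congr fun z _ => ?_)
        (fun m hm => by omega) ?_
      · have := coeff_zpow 0 0
        simp only [zpow_zero, if_true] at this
        simp [this]
      · simp only [one_div, inv_zpow', pow_one]
        ring
      · intro m n
        have := coeff_zpow 0 ((n : ℤ) - (m : ℕ))
        simp only [zpow_zero] at this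
        rw [this]
        by_cases h : n = (m : ℕ)
        · simp [h]
        · have h' : (0 : ℤ) ≠ (n : ℤ) - (m : ℕ) := by omega
          simp [h, h']
    · obtain ⟨g, hg⟩ := exists_areShiftedCoeffs hR (fun z hz => by
        have h1 := hF.conj.eq_tsum z hz
        simp only [Complex.conj_ofReal] at h1
        rw [map_div₀, map_one, h1, ← hF.eq_tsum z hz]) (-κ - 1).toNat
      have hcancel : ∀ z : ℂ, ‖z‖ = 1 →
          symbol (gapCoupling a β γ) z * (1 / symbol (gapCoupling a β γ) z) = 1 := fun z hz =>
        mul_one_div_cancel (hgap.1.2 z hz)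
      refine ⟨g, hg, ?_, ?_, ?_⟩
      -- Multiplication by `1/f_g` leaves `z^κ (z - 1)/2`, of degree `κ + 1`; for the two gapped
      -- chains it leaves `z^κ` and `z^{κ+1}`, so the same `L` serves all three.
      · refine hasEdgeModes_majB_of_wiener (L := κ + 1) htF hR hR0
          ((((Wiener.monomial_Iic (le_refl κ)).mul_Iic hp).const_mul ((1 / 2 : ℝ) : ℂ)).congr
            fun z hz => ?_) (fun m hm => by omega) hg
        linear_combination (z ^ κ * ((1 / 2 : ℝ) : ℂ) * (z - 1)) * hcancel z hz
      · refine hasEdgeModes_majB_of_wiener (L := κ + 1) (hF.zpow_mul κ) hR hR0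
          ((Wiener.monomial_Iic (j := κ) (by omega)).congr fun z hz => ?_) (fun m hm => by omega) hg
        linear_combination z ^ κ * hcancel z hz
      · refine hasEdgeModes_majB_of_wiener (L := κ + 1) (hF.zpow_mul (κ + 1)) hR hR0
          ((Wiener.monomial_Iic le_rfl).congr fun z hz => ?_) (fun m hm => by omega) hg
        linear_combination z ^ (κ + 1) * hcancel z hz

end BDI

theorem mainTheorem6 :
    -- critical chains `f_crit(z) = (z - 1)^d f_gap(z)`
    (∀ (d : ℕ) (α : ℝ) (t : ℤ → ℝ) (fgap : ℂ → ℂ) (ω : ℤ),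
      (d : ℝ) + 1 < α → BDI.IsDecaying α t →
      BDI.Gapped fgap → BDI.HasWindingNumber fgap ω →
      (∀ z : ℂ, ‖z‖ = 1 → BDI.symbol t z = (z - 1) ^ d * fgap z) →
      ∃ s : ℤ → ℝ, BDI.IsDecaying (α - d) s ∧
        (∀ z : ℂ, ‖z‖ = 1 → BDI.symbol s z = fgap z) ∧
        ∃ V : ℂ → ℂ, BDI.IsWienerHopfLog fgap ω V ∧
          (∀ z : ℂ, ‖z‖ = 1 →
            fgap z = Complex.exp (BDI.coeff V 0) * z ^ ω * BDI.bPlus V z * BDI.bMinus V z) ∧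
          (∃ g : Fin ω.toNat → ℕ → ℝ,
            BDI.AreShiftedCoeffs (fun z => 1 / BDI.bMinus V (1 / z)) g ∧
            BDI.HasEdgeModes BDI.majA t g ∧
            ∀ j : ℕ, j ≤ d → BDI.HasEdgeModes BDI.majA (BDI.shift j s) g) ∧
          (∃ g : Fin (-ω - (d : ℤ)).toNat → ℕ → ℝ,
            BDI.AreShiftedCoeffs (fun z => 1 / BDI.bPlus V z) g ∧
            BDI.HasEdgeModes BDI.majB t g ∧
            ∀ j : ℕ, j ≤ d → BDI.HasEdgeModes BDI.majB (BDI.shift j s) g)) ∧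
    -- the interpolating polylogarithmic example
    (∀ β γ : ℝ, 2 < β → 2 < γ →
      (∀ a : ℝ, BDI.IsDecaying (min β γ - 1) (BDI.gapCoupling a β γ) ∧
        ∀ z : ℂ, ‖z‖ = 1 → BDI.interp a β γ (1 / 2) z =
          (1 / 2) * ((z - 1) * BDI.symbol (BDI.gapCoupling a β γ) z)) ∧
      ∃ a₀ : ℝ, 0 < a₀ ∧ ∀ a : ℝ, |a| < a₀ →
        (BDI.Gapped (BDI.interp a β γ 0) ∧ BDI.HasWindingNumber (BDI.interp a β γ 0) 0) ∧
        (BDI.Gapped (BDI.interp a β γ 1) ∧ BDI.HasWindingNumber (BDI.interp a β γ 1) 1) ∧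
        (∀ lam : ℝ, BDI.interp a β γ lam 1 = 0 ↔ lam = 1 / 2) ∧
        (BDI.Gapped (BDI.symbol (BDI.gapCoupling a β γ)) ∧
          BDI.HasWindingNumber (BDI.symbol (BDI.gapCoupling a β γ)) 0) ∧
        ∀ κ : ℤ, ∃ t : ℤ → ℝ, BDI.IsDecaying (min β γ) t ∧
          (∀ z : ℂ, ‖z‖ = 1 → BDI.symbol t z = z ^ κ * BDI.interp a β γ (1 / 2) z) ∧
          BDI.HasEdgeModes BDI.majA t
            (fun (m : Fin κ.toNat) (n : ℕ) => if n = (m : ℕ) then 1 else 0) ∧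
          ∃ g : Fin (-κ - 1).toNat → ℕ → ℝ,
            BDI.AreShiftedCoeffs
              (fun z => 1 / BDI.symbol (BDI.gapCoupling a β γ) z) g ∧
            BDI.HasEdgeModes BDI.majB t g ∧
            BDI.HasEdgeModes BDI.majB (BDI.shift κ (BDI.gapCoupling a β γ)) g ∧
            BDI.HasEdgeModes BDI.majB (BDI.shift (κ + 1) (BDI.gapCoupling a β γ)) g) :=
  ⟨BDI.critical_chains, BDI.interp_example⟩
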